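/- For each index $l=1,2,\dots$ consider a linear model $y=X\beta^*+\varepsilon$ with $N$ observations and $n$ predictors, and an undirected graph $\mathcal G$ on the nodes $\{1,\dots,n\}$ with maximum degree $d$. All quantities may vary with $l$ except the order $k\ge 0$, the number $\nu\in[0,1)$ and the constants named below, and $N,n\to\infty$. Let $F$ be the oriented incidence matrix of $\mathcal G$ (the row of the edge $(a,b)$, $a<b$, has $-1$ at $a$, $+1$ at $b$ and $0$ elsewhere), $L=F^TF$, and let $\Delta^{(k+1)}=FL^{k/2}$ for even $k$ and $\Delta^{(k+1)}=L^{(k+1)/2}$ for odd $k$. Write $\|v\|_0$ for the number of nonzero entries of a vector $v$. Assume the following. (i) $\|\Delta^{(k+1)}\beta^*\|_0\le s_1$ and $\|\beta^*\|_0\le s_2$ for integers $s_1,s_2\ge1$ with $s_2/s_1\ge\nu$. (ii) The rows $X_i$ of $X$ are i.i.d. with mean zero and covariance matrix $\Sigma_x$, and are $\sigma_x$-sub-Gaussian: $\mathbb E\exp(t\,u^TX_i)\le\exp(\sigma_x^2t^2/2)$ for all $t\in\mathbb R$ and all unit vectors $u$. The eigenvalues of $\Sigma_x$ lie in $[c,c']$.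 Here $\sigma_x,c,c'>0$ are constants. (iii) $\varepsilon\sim N(0,\sigma_\varepsilon^2I_N)$ is independent of $X$, and $\sigma_\varepsilon>0$ is known. (iv) Every row of $\Theta_x=\Sigma_x^{-1}$ has $\ell_1$-norm at most $M_n$. Let $\hat\beta$ be a minimizer over $\beta\in\mathbb R^n$ of $$\frac1{2N}\|y-X\beta\|_2^2+\lambda_g\|\Delta^{(k+1)}\beta\|_1+\lambda\|\beta\|_1 .$$ Let $\Sigma_N=X^TX/N$, and let $\widehat\Theta$, a function of $X$ only, be a minimizer of $\sum_{a,b}|\Theta_{ab}|$ over all $\Theta\in\mathbb R^{n\times n}$ with $\max_{a,b}|(\Theta\Sigma_N-I_n)_{ab}|\le\mu$ (arbitrary if there is no such $\Theta$). Let $$\tilde\beta=\hat\beta+\frac1N\widehat\Theta X^T(y-X\hat\beta).$$ Then there is a constant $C_0>0$, depending only on $\sigma_x,c,c'$, such that the following holds for every constant $C_1$. Suppose that $$C_0\,\sigma_\varepsilon\sqrt{\tfrac{\log n}N}\le\lambda\le C_1\,\sigma_\varepsilon\sqrt{\tfrac{\log n}N},\qquad C_0\sqrt{\tfrac{\log n}N}\le\mu\le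 C_1\sqrt{\tfrac{\log n}N},$$ that $\lambda_g=\lambda\sqrt{\nu/(2d)^{k+1}}$ (the value of $\lambda_g$ is immaterial, and is taken to be $0$, if $\mathcal G$ has no edges), and that $s_2\log n/\sqrt N\to0$ and $M_n\sqrt{\log n/N}\to0$. Then, for every choice of $j=j_l\in\{1,\dots,n\}$, $$\frac{\sqrt N(\tilde\beta_j-\beta_j^*)}{\sigma_\varepsilon\sqrt{e_j^T\widehat\Theta\Sigma_N\widehat\Theta^Te_j}}\longrightarrow N(0,1)\quad\text{in distribution.}$$ Consequently, for every $\alpha\in(0,1)$, with $z=\Phi^{-1}(1-\alpha/2)$ and $\Phi$ the standard normal distribution function: (a) the interval with endpoints $\tilde\beta_j\pm z\,\sigma_\varepsilon\sqrt{e_j^T\widehat\Theta\Sigma_N\widehat\Theta^Te_j/N}$ contains $\beta^*_j$ with probability tending to $1-\alpha$; (b) if $\beta_j^*=0$ for all $l$, the probability that $\left|\sqrt N\tilde\beta_j\big/\bigl(\sigma_\varepsilon\sqrt{e_j^T\widehat\Theta\Sigma_N\widehat\Theta^Te_j}\bigr)\right|>z$ tends to $\alpha$. -/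

import Mathlib

open MeasureTheory ProbabilityTheory Filter Topology
open scoped Matrix

/-! ### Graph difference operators -/

/-- The edges `(i, j)`, `i < j`, of a graph on the vertices `0, …, n - 1`. -/
def GraphEdge {n : ℕ} (G : SimpleGraph (Fin n)) : Type :=
  {e : Fin n × Fin n // e.1 < e.2 ∧ G.Adj e.1 e.2}

noncomputable instance {n : ℕ} (G : SimpleGraph (Fin n)) : Fintype (GraphEdge G) :=
  haveI : Finite (GraphEdge G) := by unfold GraphEdge; infer_instance
  Fintype.ofFinite _

/-- The oriented incidence matrix: the row of the edge `(i, j)`, `i < j`, has the entry `-1` at `i`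
and `+1` at `j`. -/
def orientedIncidence {n : ℕ} (G : SimpleGraph (Fin n)) : Matrix (GraphEdge G) (Fin n) ℝ :=
  Matrix.of fun e v => if v = e.1.1 then -1 else if v = e.1.2 then 1 else 0

/-- The graph Laplacian `L = Fᵀ F`. -/
noncomputable def graphLaplacian {n : ℕ} (G : SimpleGraph (Fin n)) : Matrix (Fin n) (Fin n) ℝ :=
  (orientedIncidence G)ᵀ * orientedIncidence G

/-- The row index set of a graph difference operator `Δ^(k+1)`: edges if `k` is even (`true`),
nodes if `k` is odd (`false`). -/
def DiffRow {n : ℕ} (G : SimpleGraph (Fin n)) : Bool → Type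
  | true => GraphEdge G
  | false => Fin n

noncomputable instance {n : ℕ} (G : SimpleGraph (Fin n)) : (b : Bool) → Fintype (DiffRow G b)
  | true => inferInstanceAs (Fintype (GraphEdge G))
  | false => inferInstanceAs (Fintype (Fin n))

/-- The two closed forms of the graph difference operator of order `k + 1`. -/
noncomputable def graphDiffAux {n : ℕ} (G : SimpleGraph (Fin n)) (k : ℕ) :
    (b : Bool) → Matrix (DiffRow G b) (Fin n) ℝ
  | true => orientedIncidence G * graphLaplacian G ^ (k / 2)
  | false => graphLaplacian G ^ ((k + 1) / 2)

/-- The graph difference operator `Δ^(k+1)` of order `k + 1`: it is `F L^(k/2)` for even `k` and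
`L^((k+1)/2)` for odd `k`. -/
noncomputable def graphDiff {n : ℕ} (G : SimpleGraph (Fin n)) (k : ℕ) :
    Matrix (DiffRow G (decide (Even k))) (Fin n) ℝ :=
  graphDiffAux G k (decide (Even k))

open Classical in
/-- The maximum degree of the graph. -/
noncomputable def graphMaxDegree {n : ℕ} (G : SimpleGraph (Fin n)) : ℕ := G.maxDegree

/-- The `ℓ₁`-norm of a vector. -/
def vecL1 {ι : Type*} [Fintype ι] (v : ι → ℝ) : ℝ := ∑ i, |v i|

/-- The parameter space `S(k, s₁, s₂)`: `‖Δ^(k+1) β‖₀ ≤ s₁` and `‖β‖₀ ≤ s₂`. -/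
def paramSpace {n : ℕ} (G : SimpleGraph (Fin n)) (k s₁ s₂ : ℕ) : Set (Fin n → ℝ) :=
  {β | hammingNorm (graphDiff G k *ᵥ β) ≤ s₁ ∧ hammingNorm β ≤ s₂}

/-! ### The data -/

/-- A real random variable `Z` is `σ`-sub-Gaussian: it has mean zero and
`E exp (t Z) ≤ exp (σ² t² / 2)` for all real `t`. -/
def IsSubGaussian {Ω : Type*} [MeasurableSpace Ω] (σ : ℝ) (Z : Ω → ℝ) (P : Measure Ω) : Prop :=
  (Integrable Z P ∧ ∫ ω, Z ω ∂P = 0) ∧ HasSubgaussianMGF Z (σ ^ 2).toNNReal P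

/-- A random vector `V` is `σ`-sub-Gaussian: it has mean zero and `uᵀ V` is `σ`-sub-Gaussian for
every unit vector `u` of the Euclidean norm. -/
def IsSubGaussianVec {Ω : Type*} [MeasurableSpace Ω] {n : ℕ} (σ : ℝ) (V : Ω → Fin n → ℝ)
    (P : Measure Ω) : Prop :=
  (∀ a, Integrable (fun ω => V ω a) P ∧ ∫ ω, V ω a ∂P = 0) ∧
    ∀ u : Fin n → ℝ, ∑ a, u a ^ 2 = 1 → IsSubGaussian σ (fun ω => u ⬝ᵥ V ω) P

/-- `X` is a row-wise `(σ, S)`-sub-Gaussian random matrix: its rows are i.i.d. draws from a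
`σ`-sub-Gaussian distribution with covariance matrix `S`. -/
structure IsRowwiseSubGaussian {Ω : Type*} [MeasurableSpace Ω] {N n : ℕ} (σ : ℝ)
    (S : Matrix (Fin n) (Fin n) ℝ) (X : Ω → Fin N → Fin n → ℝ) (P : Measure Ω) : Prop where
  measurable : Measurable X
  indep : iIndepFun (fun (i : Fin N) ω => X ω i) P
  identDistrib : ∀ i i' : Fin N, IdentDistrib (fun ω => X ω i) (fun ω => X ω i') P P
  subGaussian : ∀ i : Fin N, IsSubGaussianVec σ (fun ω => X ω i) P
  covariance_eq : ∀ (i : Fin N) (a b : Fin n), cov[fun ω => X ω i a, fun ω => X ω i b; P] = S a b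

/-- `ε ∼ N(0, σ² I_N)`: the coordinates are i.i.d. normal with mean `0` and variance `σ²`. -/
structure IsGaussianNoise {Ω : Type*} [MeasurableSpace Ω] {N : ℕ} (σ : ℝ)
    (ε : Ω → Fin N → ℝ) (P : Measure Ω) : Prop where
  measurable : Measurable ε
  indep : iIndepFun (fun (i : Fin N) ω => ε ω i) P
  law : ∀ i : Fin N, P.map (fun ω => ε ω i) = gaussianReal 0 (σ ^ 2).toNNReal

/-- The response `y = X β* + ε` of the linear model. -/
def response {N n : ℕ} (X : Fin N → Fin n → ℝ) (β : Fin n → ℝ) (ε : Fin N → ℝ) : Fin N → ℝ :=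
  Matrix.of X *ᵥ β + ε

/-- `Σ_N = Xᵀ X / N`. -/
noncomputable def sampleCov {N n : ℕ} (X : Fin N → Fin n → ℝ) : Matrix (Fin n) (Fin n) ℝ :=
  (1 / (N : ℝ)) • ((Matrix.of X)ᵀ * Matrix.of X)

/-! ### The estimators -/

/-- The objective function of the `k`-th order Graph-Piecewise-Polynomial-Lasso:
`‖y - X β‖₂² / (2 N) + lamg ‖Δ^(k+1) β‖₁ + lam ‖β‖₁`. -/
noncomputable def gpplObjective {N n : ℕ} (G : SimpleGraph (Fin n)) (k : ℕ) (lamg lam : ℝ)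
    (X : Fin N → Fin n → ℝ) (y : Fin N → ℝ) (β : Fin n → ℝ) : ℝ :=
  1 / (2 * (N : ℝ)) * ∑ i, (y i - (Matrix.of X *ᵥ β) i) ^ 2
    + lamg * vecL1 (graphDiff G k *ᵥ β) + lam * vecL1 β

/-- `b` is a `k`-th order Graph-Piecewise-Polynomial-Lasso. -/
def IsGPPLasso {N n : ℕ} (G : SimpleGraph (Fin n)) (k : ℕ) (lamg lam : ℝ)
    (X : Fin N → Fin n → ℝ) (y : Fin N → ℝ) (b : Fin n → ℝ) : Prop :=
  IsMinOn (gpplObjective G k lamg lam X y) Set.univ b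

/-- The constraint `‖Θ S - I‖_∞ ≤ mu` (in the entrywise maximum norm) of the CLIME program. -/
def climeFeasible {n : ℕ} (S : Matrix (Fin n) (Fin n) ℝ) (mu : ℝ) :
    Set (Matrix (Fin n) (Fin n) ℝ) :=
  {Θ | ∀ a b, |(Θ * S - 1) a b| ≤ mu}

/-- `Θ` is a solution of the CLIME program: it minimizes the entrywise `ℓ₁`-norm over the
feasible matrices. -/
def IsCLIME {n : ℕ} (S : Matrix (Fin n) (Fin n) ℝ) (mu : ℝ)
    (Θ : Matrix (Fin n) (Fin n) ℝ) : Prop :=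
  Θ ∈ climeFeasible S mu ∧
    IsMinOn (fun T : Matrix (Fin n) (Fin n) ℝ => ∑ a, ∑ b, |T a b|) (climeFeasible S mu) Θ

/-- The one-step estimator `b + Θ Xᵀ (y - X b) / N`. -/
noncomputable def oneStep {N n : ℕ} (Θ : Matrix (Fin n) (Fin n) ℝ) (X : Fin N → Fin n → ℝ)
    (y : Fin N → ℝ) (b : Fin n → ℝ) : Fin n → ℝ :=
  b + (1 / (N : ℝ)) • (Θ *ᵥ ((Matrix.of X)ᵀ *ᵥ (y - Matrix.of X *ᵥ b)))

/-- `e_jᵀ Θ Σ_N Θᵀ e_j`. -/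
noncomputable def oneStepVar {N n : ℕ} (Θ : Matrix (Fin n) (Fin n) ℝ) (X : Fin N → Fin n → ℝ)
    (j : Fin n) : ℝ :=
  (Θ * sampleCov X * Θᵀ) j j

/-- The quantile function `Φ⁻¹` of the standard normal distribution. -/
noncomputable def stdNormalQuantile (q : ℝ) : ℝ := sInf {x : ℝ | q ≤ cdf (gaussianReal 0 1) x}

/-
With high probability `Σ_N` is entrywise close to `Σ_x`, the score `Xᵀ ε / N` is at most `lam / 2`,
and the precision matrix `Σ_x⁻¹` is feasible for the CLIME program. On that event the basic
inequality gives an `ℓ₁`-error of order `s₂ * lam` for the estimator. The one-step correction then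
satisfies `√N (βtilde j - β j) = (Θ Xᵀ ε) j / √N + R` with `|R| ≤ √N * mu * ‖βhat - β‖₁`; relative
to the noise level, `R` is of order `s₂ log n / √N`. Since `Θ` depends on `X` only, the first term
is exactly normal given `X`, and its variance is bounded below because the `j`-th diagonal entry
of `Θ Σ_N` is bounded away from `0` and that of `Σ_N` is bounded above.
-/

section Subexponential

variable {Ω : Type*} [MeasurableSpace Ω] {P : Measure Ω}

/-- `Z` is sub-exponential with scale `b`: near the origin, on `|t| ≤ 1 / b`, its moment generating
function is at most that of a centered normal variable of variance `2 b²`. -/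
def HasSubexponentialMGF (Z : Ω → ℝ) (b : ℝ) (P : Measure Ω) : Prop :=
  ∀ t : ℝ, |t| ≤ 1 / b →
    Integrable (fun ω => Real.exp (t * Z ω)) P ∧ mgf Z P t ≤ Real.exp (b ^ 2 * t ^ 2)

theorem lintegral_exp_mul_gaussianReal (s : ℝ) :
    ∫⁻ g, ENNReal.ofReal (Real.exp (s * g)) ∂(gaussianReal 0 1)
      = ENNReal.ofReal (Real.exp (s ^ 2 / 2)) := by
  rw [← ofReal_integral_eq_lintegral_ofReal (integrable_exp_mul_gaussianReal s)
    (Eventually.of_forall fun _ => (Real.exp_pos _).le)]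
  congr 1
  simpa [mgf] using congrFun (mgf_id_gaussianReal (μ := 0) (v := 1)) s

theorem lintegral_exp_mul_sq_gaussianReal {c : ℝ} (hc : c < 1 / 2) :
    ∫⁻ g, ENNReal.ofReal (Real.exp (c * g ^ 2)) ∂(gaussianReal 0 1)
      = ENNReal.ofReal (√(1 - 2 * c))⁻¹ := by
  have hb : 0 < 1 / 2 - c := by linarith
  have density : ∀ g : ℝ, gaussianPDF 0 1 g * ENNReal.ofReal (Real.exp (c * g ^ 2))
      = ENNReal.ofReal ((√(2 * Real.pi))⁻¹ * Real.exp (-(1 / 2 - c) * g ^ 2)) := fun g => by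
    rw [gaussianPDF, ← ENNReal.ofReal_mul (gaussianPDFReal_nonneg _ _ _), gaussianPDFReal,
      mul_assoc, ← Real.exp_add]
    simp only [NNReal.coe_one, mul_one, sub_zero]
    congr 3
    ring
  rw [gaussianReal_of_var_ne_zero 0 one_ne_zero,
    lintegral_withDensity_eq_lintegral_mul _ (measurable_gaussianPDF 0 1) (by fun_prop)]
  simp only [Pi.mul_apply, density]
  rw [← ofReal_integral_eq_lintegral_ofReal ((integrable_exp_neg_mul_sq hb).const_mul _)
    (Eventually.of_forall fun _ => by positivity), integral_const_mul, integral_gaussian,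
    ← Real.sqrt_inv, ← Real.sqrt_mul (by positivity), ← Real.sqrt_inv]
  congr 2
  have : 1 - 2 * c ≠ 0 := by linarith
  field_simp

-- Linearize the square: `exp (c u²)` is the mean of `exp (√(2 c) u g)` over a standard normal `g`.
theorem lintegral_exp_mul_sq_le [SFinite P] {U : Ω → ℝ} {v : NNReal} (hU : HasSubgaussianMGF U v P)
    {c : ℝ} (hc : 0 ≤ c) (hcv : c * v < 1 / 2) :
    ∫⁻ ω, ENNReal.ofReal (Real.exp (c * U ω ^ 2)) ∂P ≤ ENNReal.ofReal (√(1 - 2 * (c * v)))⁻¹ := by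
  have hs : √(2 * c) ^ 2 = 2 * c := Real.sq_sqrt (by positivity)
  have hm : AEMeasurable (fun p : Ω × ℝ => Real.exp (√(2 * c) * U p.1 * p.2))
      (P.prod (gaussianReal 0 1)) :=
    Real.measurable_exp.comp_aemeasurable
      ((hU.aemeasurable.comp_fst.const_mul _).mul measurable_snd.aemeasurable)
  calc ∫⁻ ω, ENNReal.ofReal (Real.exp (c * U ω ^ 2)) ∂P
      = ∫⁻ ω, ∫⁻ g, ENNReal.ofReal (Real.exp (√(2 * c) * U ω * g)) ∂(gaussianReal 0 1) ∂P := by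
        refine lintegral_congr fun ω => ?_
        rw [lintegral_exp_mul_gaussianReal, mul_pow, hs]
        congr 2
        ring
    _ = ∫⁻ g, ∫⁻ ω, ENNReal.ofReal (Real.exp (√(2 * c) * U ω * g)) ∂P ∂(gaussianReal 0 1) :=
        lintegral_lintegral_swap hm.ennreal_ofReal
    _ ≤ ∫⁻ g, ENNReal.ofReal (Real.exp (c * v * g ^ 2)) ∂(gaussianReal 0 1) := by
        refine lintegral_mono fun g => ?_
        simp only [mul_right_comm _ (U _) g]
        rw [← ofReal_integral_eq_lintegral_ofReal (hU.integrable_exp_mul _)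
          (Eventually.of_forall fun _ => (Real.exp_pos _).le)]
        refine ENNReal.ofReal_le_ofReal ((hU.mgf_le _).trans (le_of_eq ?_))
        rw [mul_pow, hs]
        congr 1
        ring
    _ = ENNReal.ofReal (√(1 - 2 * (c * v)))⁻¹ := lintegral_exp_mul_sq_gaussianReal hcv

theorem integrable_exp_mul_sq [SFinite P] {U : Ω → ℝ} {v : NNReal} (hU : HasSubgaussianMGF U v P)
    {c : ℝ} (hc : 0 ≤ c) (hcv : c * v < 1 / 2) :
    Integrable (fun ω => Real.exp (c * U ω ^ 2)) P := by
  have := hU.aemeasurable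
  refine ⟨AEMeasurable.aestronglyMeasurable (by fun_prop), ?_⟩
  rw [hasFiniteIntegral_iff_ofReal (Eventually.of_forall fun _ => (Real.exp_pos _).le)]
  exact (lintegral_exp_mul_sq_le hU hc hcv).trans_lt ENNReal.ofReal_lt_top

theorem integral_exp_mul_sq_le [SFinite P] {U : Ω → ℝ} {v : NNReal} (hU : HasSubgaussianMGF U v P)
    {c : ℝ} (hc : 0 ≤ c) (hcv : c * v < 1 / 2) :
    ∫ ω, Real.exp (c * U ω ^ 2) ∂P ≤ (√(1 - 2 * (c * v)))⁻¹ := by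
  rw [← ENNReal.ofReal_le_ofReal_iff (by positivity), ofReal_integral_eq_lintegral_ofReal
    (integrable_exp_mul_sq hU hc hcv) (Eventually.of_forall fun _ => (Real.exp_pos _).le)]
  exact lintegral_exp_mul_sq_le hU hc hcv

theorem exp_le_one_add_add_sq_mul_exp_abs (x : ℝ) :
    Real.exp x ≤ 1 + x + x ^ 2 * Real.exp |x| := by
  have taylor := Complex.norm_exp_sub_sum_le_norm_mul_exp x 2
  simp only [Finset.sum_range_succ, Finset.sum_range_zero, pow_zero, pow_one, Nat.factorial,
    Nat.cast_one, div_one, zero_add, Nat.mul_one] at taylor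
  norm_cast at taylor
  rw [Real.norm_eq_abs, Real.norm_eq_abs, sq_abs] at taylor
  linarith [le_abs_self (Real.exp x - (1 + x))]

theorem exp_mul_le_of_abs_le {b t : ℝ} (ht : |t| ≤ 1 / b) (y : ℝ) :
    Real.exp (t * y) ≤ 1 + t * y + b ^ 2 * t ^ 2 / 2 * Real.exp (3 * (|y| / b)) := by
  rcases le_or_gt b 0 with hb | hb
  · have : t = 0 := abs_nonpos_iff.1 (ht.trans (one_div_nonpos.2 hb))
    simp [this]
  set a := |y| / b with ha
  have ha0 : 0 ≤ a := by positivity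
  have hty : |t * y| ≤ a := by
    rw [abs_mul, ha, div_eq_mul_one_div, mul_comm]
    gcongr
  have hsq : (t * y) ^ 2 = b ^ 2 * t ^ 2 * a ^ 2 := by
    rw [ha, div_pow, sq_abs]
    field_simp
  have hexp : a ^ 2 ≤ Real.exp (2 * a) / 2 := by
    linarith [Real.quadratic_le_exp_of_nonneg (x := 2 * a) (by positivity)]
  calc Real.exp (t * y) ≤ 1 + t * y + (t * y) ^ 2 * Real.exp |t * y| :=
        exp_le_one_add_add_sq_mul_exp_abs _
    _ ≤ 1 + t * y + b ^ 2 * t ^ 2 * (Real.exp (2 * a) / 2) * Real.exp a := by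
        rw [hsq]
        gcongr
    _ = 1 + t * y + b ^ 2 * t ^ 2 / 2 * Real.exp (3 * a) := by
        rw [show 3 * a = 2 * a + a by ring, Real.exp_add]
        ring

theorem integrable_of_integrable_exp_mul_abs {Y : Ω → ℝ} (hY : AEStronglyMeasurable Y P) {c : ℝ}
    (hc : 0 < c) (hint : Integrable (fun ω => Real.exp (c * |Y ω|)) P) : Integrable Y P := by
  refine (hint.const_mul c⁻¹).mono' hY (Eventually.of_forall fun ω => ?_)
  rw [Real.norm_eq_abs, le_inv_mul_iff₀ hc]
  linarith [Real.add_one_le_exp (c * |Y ω|)]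

theorem hasSubexponentialMGF_sub_integral [IsProbabilityMeasure P] {Y : Ω → ℝ} {b : ℝ}
    (hb : 0 < b) (hY : AEMeasurable Y P) (hint : Integrable (fun ω => Real.exp (3 * (|Y ω| / b))) P)
    (hle : ∫ ω, Real.exp (3 * (|Y ω| / b)) ∂P ≤ 2) :
    HasSubexponentialMGF (fun ω => Y ω - ∫ ω', Y ω' ∂P) b P := by
  intro t ht
  set m := ∫ ω, Y ω ∂P
  have hYi : Integrable Y P := by
    refine integrable_of_integrable_exp_mul_abs hY.aestronglyMeasurable (c := 3 / b) (by positivity)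
      (by simpa only [mul_div_assoc, div_mul_eq_mul_div] using hint)
  have hlin : Integrable (fun ω => 1 + t * Y ω) P := (integrable_const 1).add (hYi.const_mul t)
  have hdom := hlin.add (hint.const_mul (b ^ 2 * t ^ 2 / 2))
  have htYi : Integrable (fun ω => Real.exp (t * Y ω)) P := by
    refine hdom.mono' (AEMeasurable.aestronglyMeasurable (by fun_prop))
      (Eventually.of_forall fun ω => ?_)
    rw [Real.norm_of_nonneg (Real.exp_pos _).le]
    exact exp_mul_le_of_abs_le ht (Y ω)
  have hmgf : ∫ ω, Real.exp (t * Y ω) ∂P ≤ 1 + t * m + b ^ 2 * t ^ 2 := by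
    refine (integral_mono htYi hdom fun ω => exp_mul_le_of_abs_le ht (Y ω)).trans ?_
    rw [integral_add' hlin (hint.const_mul _), integral_add (integrable_const 1)
      (hYi.const_mul t), integral_const_mul, integral_const_mul]
    simp only [integral_const, probReal_univ, smul_eq_mul, mul_one]
    linarith [mul_le_mul_of_nonneg_left hle (show 0 ≤ b ^ 2 * t ^ 2 / 2 by positivity)]
  have hshift : ∀ ω, Real.exp (t * (Y ω - m)) = Real.exp (-(t * m)) * Real.exp (t * Y ω) :=
    fun ω => by rw [← Real.exp_add]; congr 1; ring
  simp only [mgf, hshift, integral_const_mul]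
  refine ⟨htYi.const_mul _, ?_⟩
  calc Real.exp (-(t * m)) * ∫ ω, Real.exp (t * Y ω) ∂P
      ≤ Real.exp (-(t * m)) * Real.exp (t * m + b ^ 2 * t ^ 2) := by
        gcongr
        linarith [Real.add_one_le_exp (t * m + b ^ 2 * t ^ 2)]
    _ = Real.exp (b ^ 2 * t ^ 2) := by rw [← Real.exp_add]; congr 1; ring

theorem HasSubexponentialMGF.neg {Z : Ω → ℝ} {b : ℝ} (hZ : HasSubexponentialMGF Z b P) :
    HasSubexponentialMGF (fun ω => -Z ω) b P := by
  intro t ht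
  have h := hZ (-t) (by rwa [abs_neg])
  rw [← mgf_neg, neg_sq] at h
  simpa only [mul_neg, neg_mul, Pi.neg_def] using h

theorem exp_abs_mul_le {σ τ : ℝ} (hσ : 0 < σ) (hτ : 0 < τ) (u w : ℝ) :
    Real.exp (3 * (|u * w| / (9 * (σ * τ))))
      ≤ (Real.exp (1 / (3 * σ ^ 2) * u ^ 2) + Real.exp (1 / (3 * τ ^ 2) * w ^ 2)) / 2 := by
  set p := |u| / σ with hp
  set q := |w| / τ with hq
  have hpq : 3 * (|u * w| / (9 * (σ * τ))) ≤ p ^ 2 / 6 + q ^ 2 / 6 := by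
    have : 3 * (|u * w| / (9 * (σ * τ))) = p * q / 3 := by rw [abs_mul, hp, hq]; field_simp; ring
    nlinarith [sq_nonneg (p - q)]
  have hu : Real.exp (1 / (3 * σ ^ 2) * u ^ 2) = Real.exp (p ^ 2 / 6) ^ 2 := by
    rw [← Real.exp_nat_mul, hp, div_pow, sq_abs]
    congr 1
    field_simp
    ring
  have hw : Real.exp (1 / (3 * τ ^ 2) * w ^ 2) = Real.exp (q ^ 2 / 6) ^ 2 := by
    rw [← Real.exp_nat_mul, hq, div_pow, sq_abs]
    congr 1
    field_simp
    ring
  calc _ ≤ Real.exp (p ^ 2 / 6) * Real.exp (q ^ 2 / 6) := by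
        rw [← Real.exp_add]
        exact Real.exp_le_exp.2 hpq
    _ ≤ _ := by
        rw [hu, hw]
        linarith [two_mul_le_add_sq (Real.exp (p ^ 2 / 6)) (Real.exp (q ^ 2 / 6))]

theorem hasSubexponentialMGF_mul_sub_integral [IsProbabilityMeasure P] {U W : Ω → ℝ} {σ τ : ℝ}
    (hσ : 0 < σ) (hτ : 0 < τ) (hU : HasSubgaussianMGF U (σ ^ 2).toNNReal P)
    (hW : HasSubgaussianMGF W (τ ^ 2).toNNReal P) :
    HasSubexponentialMGF (fun ω => U ω * W ω - ∫ ω', U ω' * W ω' ∂P) (9 * (σ * τ)) P := by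
  have hUm := hU.aemeasurable
  have hWm := hW.aemeasurable
  have third : ∀ {s : ℝ}, 0 < s → 1 / (3 * s ^ 2) * ((s ^ 2).toNNReal : ℝ) = 1 / 3 := fun hs => by
    rw [Real.coe_toNNReal _ (sq_nonneg _)]
    field_simp
  have sqrt_third : (√(1 - 2 * (1 / 3 : ℝ)))⁻¹ ≤ 2 := by
    rw [← Real.sqrt_inv]
    exact Real.sqrt_le_iff.2 (by norm_num)
  have moment : ∀ {s : ℝ} {Z : Ω → ℝ}, 0 < s → HasSubgaussianMGF Z (s ^ 2).toNNReal P →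
      Integrable (fun ω => Real.exp (1 / (3 * s ^ 2) * Z ω ^ 2)) P ∧
        ∫ ω, Real.exp (1 / (3 * s ^ 2) * Z ω ^ 2) ∂P ≤ 2 := fun hs hZ =>
    ⟨integrable_exp_mul_sq hZ (by positivity) (by rw [third hs]; norm_num),
      (integral_exp_mul_sq_le hZ (by positivity) (by rw [third hs]; norm_num)).trans
        (by rwa [third hs])⟩
  obtain ⟨hUi, hU2⟩ := moment hσ hU
  obtain ⟨hWi, hW2⟩ := moment hτ hW
  have hdom := (hUi.add hWi).div_const 2
  have hint : Integrable (fun ω => Real.exp (3 * (|U ω * W ω| / (9 * (σ * τ))))) P :=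
    hdom.mono' (AEMeasurable.aestronglyMeasurable (by fun_prop)) (Eventually.of_forall fun ω =>
      (Real.norm_of_nonneg (Real.exp_pos _).le).trans_le (exp_abs_mul_le hσ hτ _ _))
  refine hasSubexponentialMGF_sub_integral (by positivity) (hUm.mul hWm) hint ?_
  refine (integral_mono hint hdom fun ω => exp_abs_mul_le hσ hτ _ _).trans ?_
  rw [integral_div]
  simp only [Pi.add_apply]
  rw [integral_add hUi hWi]
  linarith

theorem HasSubexponentialMGF.measureReal_le_sum_le {ι : Type*} [Fintype ι] [IsFiniteMeasure P]
    {Z : ι → Ω → ℝ} (hm : ∀ i, Measurable (Z i)) (hind : iIndepFun Z P) {b δ : ℝ} (hb : 0 < b)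
    (hZ : ∀ i, HasSubexponentialMGF (Z i) b P) (hδ : 0 ≤ δ) (hδb : δ ≤ 2 * b) :
    P.real {ω | Fintype.card ι * δ ≤ ∑ i, Z i ω}
      ≤ Real.exp (-(Fintype.card ι * δ ^ 2 / (4 * b ^ 2))) := by
  -- the exponent `-t δ + b² t²` of the Chernoff bound is minimal at this `t`
  set t := δ / (2 * b ^ 2) with ht
  have ht0 : 0 ≤ t := by positivity
  have htb : |t| ≤ 1 / b := by
    rw [abs_of_nonneg ht0, ht, div_le_div_iff₀ (by positivity) hb]
    nlinarith
  have chernoff := measure_ge_le_exp_mul_mgf (Fintype.card ι * δ) ht0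
    (hind.integrable_exp_mul_sum hm (s := Finset.univ) fun i _ => (hZ i t htb).1)
  simp only [Finset.sum_apply] at chernoff
  calc _ ≤ Real.exp (-t * (Fintype.card ι * δ)) * mgf (∑ i, Z i) P t := chernoff
    _ ≤ Real.exp (-t * (Fintype.card ι * δ)) * ∏ _i : ι, Real.exp (b ^ 2 * t ^ 2) := by
        rw [hind.mgf_sum hm Finset.univ]
        gcongr with i
        · exact fun _ _ => mgf_nonneg
        · exact (hZ i t htb).2
    _ = Real.exp (-(Fintype.card ι * δ ^ 2 / (4 * b ^ 2))) := by
        rw [Finset.prod_const, Finset.card_univ, ← Real.exp_nat_mul, ← Real.exp_add, ht]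
        congr 1
        field_simp
        ring

theorem HasSubexponentialMGF.measureReal_le_abs_sum_le {ι : Type*} [Fintype ι] [IsFiniteMeasure P]
    {Z : ι → Ω → ℝ} (hm : ∀ i, Measurable (Z i)) (hind : iIndepFun Z P) {b δ : ℝ} (hb : 0 < b)
    (hZ : ∀ i, HasSubexponentialMGF (Z i) b P) (hδ : 0 ≤ δ) (hδb : δ ≤ 2 * b) :
    P.real {ω | Fintype.card ι * δ ≤ |∑ i, Z i ω|}
      ≤ 2 * Real.exp (-(Fintype.card ι * δ ^ 2 / (4 * b ^ 2))) := by
  have upper := measureReal_le_sum_le hm hind hb hZ hδ hδb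
  have lower := measureReal_le_sum_le (fun i => (hm i).neg)
    (hind.comp (fun _ x => -x) fun _ => measurable_neg) hb (fun i => (hZ i).neg) hδ hδb
  simp only [Pi.neg_apply, Finset.sum_neg_distrib] at lower
  have hunion : {ω | Fintype.card ι * δ ≤ |∑ i, Z i ω|}
      = {ω | Fintype.card ι * δ ≤ ∑ i, Z i ω} ∪ {ω | Fintype.card ι * δ ≤ -∑ i, Z i ω} :=
    Set.ext fun ω => by simp only [Set.mem_union, Set.mem_ofPred_eq, le_abs]
  rw [hunion, two_mul]
  exact (measureReal_union_le _ _).trans (add_le_add upper lower)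

theorem measureReal_lt_abs_average_mul_sub_le [IsProbabilityMeasure P] {N : ℕ} (hN : 0 < N)
    {U W : Fin N → Ω → ℝ} {σ τ m ρ : ℝ} (hσ : 0 < σ) (hτ : 0 < τ)
    (hUm : ∀ i, Measurable (U i)) (hWm : ∀ i, Measurable (W i))
    (hU : ∀ i, HasSubgaussianMGF (U i) (σ ^ 2).toNNReal P)
    (hW : ∀ i, HasSubgaussianMGF (W i) (τ ^ 2).toNNReal P)
    (hind : iIndepFun (fun i ω => U i ω * W i ω) P) (hm : ∀ i, ∫ ω, U i ω * W i ω ∂P = m)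
    (hρ : 0 ≤ ρ) (hρ' : ρ ≤ 1 / 2) :
    P.real {ω | 36 * (σ * τ) * ρ < |1 / (N : ℝ) * ∑ i, U i ω * W i ω - m|}
      ≤ 2 * Real.exp (-(4 * (N * ρ ^ 2))) := by
  have hN' : (0 : ℝ) < N := Nat.cast_pos.2 hN
  have tail := HasSubexponentialMGF.measureReal_le_abs_sum_le (b := 9 * (σ * τ))
    (δ := 36 * (σ * τ) * ρ) (Z := fun i ω => U i ω * W i ω - m)
    (fun i => ((hUm i).mul (hWm i)).sub_const m)
    (hind.comp (fun _ x => x - m) fun _ => by fun_prop) (by positivity)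
    (fun i => by simpa only [hm i] using hasSubexponentialMGF_mul_sub_integral hσ hτ (hU i) (hW i))
    (by positivity) (by nlinarith [mul_pos hσ hτ])
  have hexp : (N : ℝ) * (36 * (σ * τ) * ρ) ^ 2 / (4 * (9 * (σ * τ)) ^ 2) = 4 * (N * ρ ^ 2) := by
    field_simp
    ring
  rw [Fintype.card_fin, hexp] at tail
  refine (measureReal_mono fun ω hω => ?_).trans tail
  have hsum : ∑ i, (U i ω * W i ω - m) = N * (1 / (N : ℝ) * ∑ i, U i ω * W i ω - m) := by
    rw [Finset.sum_sub_distrib, Finset.sum_const, Finset.card_univ, Fintype.card_fin, nsmul_eq_mul]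
    field_simp
  simp only [Set.mem_ofPred_eq] at hω ⊢
  rw [hsum, abs_mul, abs_of_pos hN']
  exact mul_le_mul_of_nonneg_left (le_of_lt hω) hN'.le

end Subexponential

section GraphDifference

open scoped Matrix.Norms.L2Operator

theorem norm_toLp_sq {ι : Type*} [Fintype ι] (v : ι → ℝ) :
    ‖WithLp.toLp 2 v‖ ^ 2 = ∑ i, v i ^ 2 := by
  simp [EuclideanSpace.norm_sq_eq]

theorem sum_sq_mulVec_le {m n : Type*} [Fintype m] [Fintype n] [DecidableEq n] (A : Matrix m n ℝ)
    (v : n → ℝ) : ∑ i, (A *ᵥ v) i ^ 2 ≤ ‖A‖ ^ 2 * ∑ a, v a ^ 2 := by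
  rw [← norm_toLp_sq, ← norm_toLp_sq, ← mul_pow]
  exact pow_le_pow_left₀ (norm_nonneg _) (A.l2_opNorm_mulVec (WithLp.toLp 2 v)) 2

theorem sq_l2_opNorm_le {m n : Type*} [Fintype m] [Fintype n] [DecidableEq n] {A : Matrix m n ℝ}
    {C : ℝ} (hC : 0 ≤ C) (h : ∀ v, ∑ i, (A *ᵥ v) i ^ 2 ≤ C * ∑ a, v a ^ 2) : ‖A‖ ^ 2 ≤ C := by
  suffices ‖A‖ ≤ √C from (Real.le_sqrt (norm_nonneg A) hC).1 this
  rw [Matrix.l2_opNorm_def]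
  refine ContinuousLinearMap.opNorm_le_bound _ (Real.sqrt_nonneg C) fun v => ?_
  refine le_of_sq_le_sq ?_ (by positivity)
  rw [mul_pow, Real.sq_sqrt hC]
  simpa [EuclideanSpace.norm_sq_eq] using h v

variable {n : ℕ} (G : SimpleGraph (Fin n))

theorem sum_graphEdge_add [DecidableRel G.Adj] (f : Fin n → ℝ) :
    ∑ e : GraphEdge G, (f e.1.1 + f e.1.2) = ∑ a, G.degree a * f a := by
  have edges : ∑ e : GraphEdge G, (f e.1.1 + f e.1.2)
      = ∑ p : Fin n × Fin n with p.1 < p.2 ∧ G.Adj p.1 p.2, (f p.1 + f p.2) :=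
    Finset.sum_bij (fun e _ => e.1) (fun e _ => Finset.mem_filter.2 ⟨Finset.mem_univ _, e.2⟩)
      (fun _ _ _ _ h => Subtype.ext h)
      (fun p hp => ⟨⟨p, (Finset.mem_filter.1 hp).2⟩, Finset.mem_univ _, rfl⟩) fun _ _ => rfl
  have degree : ∀ a, (G.degree a : ℝ) * f a = ∑ b, if G.Adj a b then f a else 0 := fun a => by
    rw [← Finset.sum_filter, Finset.sum_const, nsmul_eq_mul, ← G.card_neighborFinset_eq_degree,
      G.neighborFinset_eq_filter]
  rw [edges, Finset.sum_add_distrib, Finset.sum_filter, Finset.sum_filter, Fintype.sum_prod_type,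
    Fintype.sum_prod_type_right, ← Finset.sum_add_distrib]
  refine Finset.sum_congr rfl fun a _ => ?_
  rw [degree, ← Finset.sum_add_distrib]
  refine Finset.sum_congr rfl fun b _ => ?_
  rcases lt_trichotomy a b with h | h | h
  · simp [h, h.not_gt]
  · simp [h]
  · simp [h, h.not_gt, G.adj_comm b a]

theorem orientedIncidence_mulVec (v : Fin n → ℝ) (e : GraphEdge G) :
    (orientedIncidence G *ᵥ v) e = v e.1.2 - v e.1.1 := by
  have row : orientedIncidence G e = Pi.single e.1.2 1 - Pi.single e.1.1 1 := by
    ext a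
    have := e.2.1.ne
    simp only [orientedIncidence, Matrix.of_apply, Pi.sub_apply, Pi.single_apply]
    split_ifs <;> simp_all
  change orientedIncidence G e ⬝ᵥ v = _
  simp [row, sub_dotProduct]

theorem sum_sq_orientedIncidence_mulVec_le (v : Fin n → ℝ) :
    ∑ e, (orientedIncidence G *ᵥ v) e ^ 2 ≤ 2 * (graphMaxDegree G : ℝ) * ∑ a, v a ^ 2 := by
  classical
  have edge : ∀ e : GraphEdge G,
      (orientedIncidence G *ᵥ v) e ^ 2 ≤ 2 * (v e.1.1 ^ 2 + v e.1.2 ^ 2) := fun e => by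
    rw [orientedIncidence_mulVec]
    linarith [sq_nonneg (v e.1.2 + v e.1.1), add_sq (v e.1.2) (v e.1.1), sub_sq (v e.1.2) (v e.1.1)]
  have degree_le : ∀ a, G.degree a ≤ graphMaxDegree G := fun a => by
    unfold graphMaxDegree
    convert G.degree_le_maxDegree a
  calc ∑ e, (orientedIncidence G *ᵥ v) e ^ 2
      ≤ ∑ e : GraphEdge G, 2 * (v e.1.1 ^ 2 + v e.1.2 ^ 2) := Finset.sum_le_sum fun e _ => edge e
    _ = 2 * ∑ a, G.degree a * v a ^ 2 := by
        rw [← Finset.mul_sum, sum_graphEdge_add G fun a => v a ^ 2]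
    _ ≤ 2 * ∑ a, graphMaxDegree G * v a ^ 2 := by
        gcongr with a
        exact degree_le a
    _ = 2 * (graphMaxDegree G : ℝ) * ∑ a, v a ^ 2 := by rw [← Finset.mul_sum, mul_assoc]

theorem l2_opNorm_graphLaplacian : ‖graphLaplacian G‖ = ‖orientedIncidence G‖ ^ 2 := by
  rw [graphLaplacian, ← Matrix.conjTranspose_eq_transpose_of_trivial,
    Matrix.l2_opNorm_conjTranspose_mul_self, sq]

theorem l2_opNorm_orientedIncidence_mul_graphLaplacian_pow_le (m : ℕ) :
    ‖orientedIncidence G * graphLaplacian G ^ m‖ ≤ ‖orientedIncidence G‖ ^ (2 * m + 1) := by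
  induction m with
  | zero => simp
  | succ m ih =>
    rw [pow_succ (graphLaplacian G), ← Matrix.mul_assoc]
    refine (Matrix.l2_opNorm_mul _ _).trans ?_
    rw [l2_opNorm_graphLaplacian]
    exact (mul_le_mul_of_nonneg_right ih (by positivity)).trans_eq (by ring)

theorem l2_opNorm_graphDiff_le (k : ℕ) : ‖graphDiff G k‖ ≤ ‖orientedIncidence G‖ ^ (k + 1) := by
  have closed_form : ∀ b : Bool, b = decide (Even k) →
      ‖graphDiffAux G k b‖ ≤ ‖orientedIncidence G‖ ^ (k + 1)
    | true, hb => by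
      have hk : 2 * (k / 2) = k := Nat.two_mul_div_two_of_even (of_decide_eq_true hb.symm)
      have := l2_opNorm_orientedIncidence_mul_graphLaplacian_pow_le G (k / 2)
      rwa [hk] at this
    | false, hb => by
      have hk : Odd k := Nat.not_even_iff_odd.1 (of_decide_eq_false hb.symm)
      have hk' : 2 * ((k + 1) / 2) = k + 1 := Nat.two_mul_div_two_of_even hk.add_one
      have := norm_pow_le' (graphLaplacian G) (n := (k + 1) / 2) (by omega)
      rwa [l2_opNorm_graphLaplacian, ← pow_mul, hk'] at this
  exact closed_form _ rfl

theorem sum_sq_graphDiff_mulVec_le (k : ℕ) (v : Fin n → ℝ) :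
    ∑ r, (graphDiff G k *ᵥ v) r ^ 2
      ≤ (2 * (graphMaxDegree G : ℝ)) ^ (k + 1) * ∑ a, v a ^ 2 := by
  have hF : ‖orientedIncidence G‖ ^ 2 ≤ 2 * graphMaxDegree G :=
    sq_l2_opNorm_le (by positivity) (sum_sq_orientedIncidence_mulVec_le G)
  calc ∑ r, (graphDiff G k *ᵥ v) r ^ 2
      ≤ (‖orientedIncidence G‖ ^ (k + 1)) ^ 2 * ∑ a, v a ^ 2 := by
        refine (sum_sq_mulVec_le _ v).trans ?_
        gcongr
        exact l2_opNorm_graphDiff_le G k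
    _ = (‖orientedIncidence G‖ ^ 2) ^ (k + 1) * ∑ a, v a ^ 2 := by rw [← pow_mul, pow_mul']
    _ ≤ (2 * (graphMaxDegree G : ℝ)) ^ (k + 1) * ∑ a, v a ^ 2 := by gcongr

end GraphDifference

section ErrorBound

variable {ι : Type*} [Fintype ι]

theorem vecL1_add_vecL1_sub_le (v w : ι → ℝ) :
    vecL1 v + vecL1 (w - v)
      ≤ vecL1 w + 2 * (√(hammingNorm v) * √(∑ i, (w - v) i ^ 2)) := by
  have off_support : vecL1 v + vecL1 (w - v) ≤ vecL1 w + 2 * ∑ i with v i ≠ 0, |(w - v) i| := by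
    simp only [vecL1, Finset.sum_filter, Finset.mul_sum, ← Finset.sum_add_distrib, Pi.sub_apply]
    refine Finset.sum_le_sum fun i _ => ?_
    by_cases hi : v i = 0
    · simp [hi]
    · rw [if_pos hi]
      linarith [abs_sub_abs_le_abs_sub (v i) (w i), abs_sub_comm (v i) (w i)]
  have cauchy_schwarz : ∑ i with v i ≠ 0, |(w - v) i|
      ≤ √(hammingNorm v) * √(∑ i, (w - v) i ^ 2) := by
    rw [← Real.sqrt_mul (Nat.cast_nonneg _)]
    refine Real.le_sqrt_of_sq_le (sq_sum_le_card_mul_sum_sq.trans ?_)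
    simp only [sq_abs, hammingNorm]
    gcongr
    exact Finset.subset_univ _
  linarith

theorem vecL1_sub_vecL1_le (v w : ι → ℝ) :
    vecL1 v - vecL1 w ≤ √(hammingNorm v) * √(∑ i, (w - v) i ^ 2) := by
  have triangle : vecL1 v - vecL1 w ≤ vecL1 (w - v) := by
    simp only [vecL1, ← Finset.sum_sub_distrib, Pi.sub_apply]
    exact Finset.sum_le_sum fun i _ =>
      (abs_sub_abs_le_abs_sub _ _).trans_eq (abs_sub_comm _ _)
  linarith [vecL1_add_vecL1_sub_le v w]

theorem abs_dotProduct_le_mul_vecL1 {u v : ι → ℝ} {κ : ℝ} (hu : ∀ i, |u i| ≤ κ) :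
    |u ⬝ᵥ v| ≤ κ * vecL1 v := by
  rw [dotProduct, vecL1, Finset.mul_sum]
  refine (Finset.abs_sum_le_sum_abs _ _).trans (Finset.sum_le_sum fun i _ => ?_)
  rw [abs_mul]
  gcongr
  exact hu i

theorem abs_dotProduct_mulVec_le {A : Matrix ι ι ℝ} {κ : ℝ} (hA : ∀ a b, |A a b| ≤ κ)
    (v : ι → ℝ) : |v ⬝ᵥ (A *ᵥ v)| ≤ κ * vecL1 v ^ 2 := by
  rw [dotProduct_comm]
  calc |(A *ᵥ v) ⬝ᵥ v| ≤ κ * vecL1 v * vecL1 v :=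
        abs_dotProduct_le_mul_vecL1 fun a => abs_dotProduct_le_mul_vecL1 (hA a)
    _ = κ * vecL1 v ^ 2 := by ring

theorem half_mul_sum_sq_le_dotProduct_mulVec {A S : Matrix ι ι ℝ} {v : ι → ℝ} {c κ m : ℝ}
    (hS : c * ∑ i, v i ^ 2 ≤ v ⬝ᵥ (S *ᵥ v)) (hA : ∀ a b, |(A - S) a b| ≤ κ) (hκ : 0 ≤ κ)
    (hv : vecL1 v ^ 2 ≤ m * ∑ i, v i ^ 2) (hm : m * κ ≤ c / 2) :
    c / 2 * ∑ i, v i ^ 2 ≤ v ⬝ᵥ (A *ᵥ v) := by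
  have hdev := neg_le_of_abs_le (abs_dotProduct_mulVec_le hA v)
  rw [Matrix.sub_mulVec, dotProduct_sub] at hdev
  have hsmall : κ * vecL1 v ^ 2 ≤ c / 2 * ∑ i, v i ^ 2 := calc
    _ ≤ κ * (m * ∑ i, v i ^ 2) := by gcongr
    _ = m * κ * ∑ i, v i ^ 2 := by ring
    _ ≤ c / 2 * ∑ i, v i ^ 2 := by gcongr
  linarith

variable {N n : ℕ}

/-- The gradient `Xᵀ ε / N` of the least squares loss at the true coefficients, up to sign. -/
noncomputable def noiseScore (X : Fin N → Fin n → ℝ) (ε : Fin N → ℝ) : Fin n → ℝ :=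
  (1 / (N : ℝ)) • ((Matrix.of X)ᵀ *ᵥ ε)

theorem dotProduct_noiseScore (X : Fin N → Fin n → ℝ) (ε : Fin N → ℝ) (v : Fin n → ℝ) :
    v ⬝ᵥ noiseScore X ε = 1 / (N : ℝ) * (Matrix.of X *ᵥ v) ⬝ᵥ ε := by
  rw [noiseScore, dotProduct_smul, Matrix.dotProduct_mulVec, Matrix.vecMul_transpose, smul_eq_mul]

theorem dotProduct_sampleCov_mulVec (X : Fin N → Fin n → ℝ) (v w : Fin n → ℝ) :
    v ⬝ᵥ (sampleCov X *ᵥ w) = 1 / (N : ℝ) * (Matrix.of X *ᵥ v) ⬝ᵥ (Matrix.of X *ᵥ w) := by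
  rw [sampleCov, Matrix.smul_mulVec, dotProduct_smul, ← Matrix.mulVec_mulVec,
    Matrix.dotProduct_mulVec, Matrix.vecMul_transpose, smul_eq_mul]

theorem vecL1_graphDiff_mulVec_sub_le (G : SimpleGraph (Fin n)) {k s : ℕ} {β : Fin n → ℝ}
    (hβ : hammingNorm (graphDiff G k *ᵥ β) ≤ s) (b : Fin n → ℝ) :
    vecL1 (graphDiff G k *ᵥ β) - vecL1 (graphDiff G k *ᵥ b)
      ≤ √(s * (2 * (graphMaxDegree G : ℝ)) ^ (k + 1)) * √(∑ a, (b - β) a ^ 2) := by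
  have hdiff := sum_sq_graphDiff_mulVec_le G k (b - β)
  rw [Matrix.mulVec_sub] at hdiff
  calc vecL1 (graphDiff G k *ᵥ β) - vecL1 (graphDiff G k *ᵥ b)
      ≤ √s * √((2 * (graphMaxDegree G : ℝ)) ^ (k + 1) * ∑ a, (b - β) a ^ 2) :=
        (vecL1_sub_vecL1_le _ _).trans (by gcongr)
    _ = _ := by rw [Real.sqrt_mul (by positivity), Real.sqrt_mul (by positivity), mul_assoc]

namespace IsGPPLasso

variable {G : SimpleGraph (Fin n)} {k s₁ s₂ : ℕ} {lamg lam c κ : ℝ} {X : Fin N → Fin n → ℝ}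
  {β b : Fin n → ℝ} {ε : Fin N → ℝ}

theorem basic_inequality (hb : IsGPPLasso G k lamg lam X (response X β ε) b) :
    (b - β) ⬝ᵥ (sampleCov X *ᵥ (b - β)) / 2
      ≤ noiseScore X ε ⬝ᵥ (b - β)
        + lamg * (vecL1 (graphDiff G k *ᵥ β) - vecL1 (graphDiff G k *ᵥ b))
        + lam * (vecL1 β - vecL1 b) := by
  have hmin := isMinOn_univ_iff.1 hb β
  have hres : ∀ i, response X β ε i - (Matrix.of X *ᵥ b) i
      = ε i - (Matrix.of X *ᵥ (b - β)) i := fun i => by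
    simp only [response, Matrix.mulVec_sub, Pi.add_apply, Pi.sub_apply]
    ring
  have hres_true : ∀ i, response X β ε i - (Matrix.of X *ᵥ β) i = ε i := fun i => by
    simp only [response, Pi.add_apply, add_sub_cancel_left]
  have hsquare : ∑ i, (ε i - (Matrix.of X *ᵥ (b - β)) i) ^ 2 = ∑ i, ε i ^ 2
      - 2 * (Matrix.of X *ᵥ (b - β)) ⬝ᵥ ε
      + (Matrix.of X *ᵥ (b - β)) ⬝ᵥ (Matrix.of X *ᵥ (b - β)) := by
    simp only [dotProduct, Finset.mul_sum, ← Finset.sum_sub_distrib, ← Finset.sum_add_distrib]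
    exact Finset.sum_congr rfl fun i _ => by ring
  have hhalf : 1 / (2 * (N : ℝ)) = 1 / (N : ℝ) / 2 := by rw [mul_comm, div_mul_eq_div_div]
  simp only [gpplObjective, hres, hres_true, hsquare, hhalf] at hmin
  rw [dotProduct_comm (noiseScore X ε), dotProduct_noiseScore, dotProduct_sampleCov_mulVec]
  linarith

theorem dotProduct_add_mul_vecL1_le (hb : IsGPPLasso G k lamg lam X (response X β ε) b)
    (hlam : 0 ≤ lam) (hβ : β ∈ paramSpace G k s₁ s₂) (hlamg : 0 ≤ lamg)
    (hpen : lamg * √(s₁ * (2 * (graphMaxDegree G : ℝ)) ^ (k + 1)) ≤ lam * √s₂)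
    (hε : ∀ a, |noiseScore X ε a| ≤ lam / 2) :
    (b - β) ⬝ᵥ (sampleCov X *ᵥ (b - β)) + lam * vecL1 (b - β)
      ≤ 6 * (lam * (√s₂ * √(∑ a, (b - β) a ^ 2))) := by
  have noise := (le_abs_self _).trans (abs_dotProduct_le_mul_vecL1 (v := b - β) hε)
  have graph : lamg * (vecL1 (graphDiff G k *ᵥ β) - vecL1 (graphDiff G k *ᵥ b))
      ≤ lam * (√s₂ * √(∑ a, (b - β) a ^ 2)) := calc
    _ ≤ lamg * (√(s₁ * (2 * (graphMaxDegree G : ℝ)) ^ (k + 1)) * √(∑ a, (b - β) a ^ 2)) := by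
        gcongr
        exact vecL1_graphDiff_mulVec_sub_le G hβ.1 b
    _ ≤ lam * √s₂ * √(∑ a, (b - β) a ^ 2) := by rw [← mul_assoc]; gcongr
    _ = _ := mul_assoc _ _ _
  have sparse : lam * (vecL1 β + vecL1 (b - β))
      ≤ lam * (vecL1 b + 2 * (√s₂ * √(∑ a, (b - β) a ^ 2))) := by
    refine mul_le_mul_of_nonneg_left ((vecL1_add_vecL1_sub_le β b).trans ?_) hlam
    gcongr
    exact hβ.2
  linarith [hb.basic_inequality]

theorem vecL1_sub_le {S : Matrix (Fin n) (Fin n) ℝ}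
    (hb : IsGPPLasso G k lamg lam X (response X β ε) b)
    (hlam : 0 < lam) (hβ : β ∈ paramSpace G k s₁ s₂) (hlamg : 0 ≤ lamg)
    (hpen : lamg * √(s₁ * (2 * (graphMaxDegree G : ℝ)) ^ (k + 1)) ≤ lam * √s₂)
    (hε : ∀ a, |noiseScore X ε a| ≤ lam / 2) (hc : 0 < c)
    (hS : ∀ v, c * ∑ a, v a ^ 2 ≤ v ⬝ᵥ (S *ᵥ v)) (hκ : 0 ≤ κ)
    (hcov : ∀ a a', |(sampleCov X - S) a a'| ≤ κ) (hκs : 36 * s₂ * κ ≤ c / 2) :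
    vecL1 (b - β) ≤ 72 / c * (lam * s₂) := by
  set r := √(∑ a, (b - β) a ^ 2)
  have hr0 : 0 ≤ r := Real.sqrt_nonneg _
  have hr2 : r ^ 2 = ∑ a, (b - β) a ^ 2 := Real.sq_sqrt (by positivity)
  have hss : √(s₂ : ℝ) ^ 2 = s₂ := Real.sq_sqrt (Nat.cast_nonneg _)
  have hL0 : 0 ≤ vecL1 (b - β) := Finset.sum_nonneg fun _ _ => abs_nonneg _
  have hmain := hb.dotProduct_add_mul_vecL1_le hlam.le hβ hlamg hpen hε
  have hq0 : 0 ≤ (b - β) ⬝ᵥ (sampleCov X *ᵥ (b - β)) := by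
    rw [dotProduct_sampleCov_mulVec]
    exact mul_nonneg (by positivity) (Finset.sum_nonneg fun _ _ => mul_self_nonneg _)
  have cone : vecL1 (b - β) ≤ 6 * (√s₂ * r) := by
    refine le_of_mul_le_mul_left ?_ hlam
    linarith
  have curvature : c / 2 * r ^ 2 ≤ (b - β) ⬝ᵥ (sampleCov X *ᵥ (b - β)) := by
    rw [hr2]
    refine half_mul_sum_sq_le_dotProduct_mulVec (hS _) hcov hκ ?_ hκs
    calc vecL1 (b - β) ^ 2 ≤ (6 * (√s₂ * r)) ^ 2 := by gcongr
      _ = 36 * s₂ * ∑ a, (b - β) a ^ 2 := by rw [mul_pow, mul_pow, hss, hr2]; ring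
  have error_l2 : c * r ≤ 12 * (lam * √s₂) := by
    rcases hr0.eq_or_lt with h | h
    · rw [← h, mul_zero]
      positivity
    · refine le_of_mul_le_mul_left ?_ h
      nlinarith [mul_nonneg hlam.le hL0]
  rw [div_mul_eq_mul_div, le_div_iff₀ hc]
  calc vecL1 (b - β) * c ≤ 6 * (√s₂ * r) * c := by gcongr
    _ = 6 * √s₂ * (c * r) := by ring
    _ ≤ 6 * √s₂ * (12 * (lam * √s₂)) := by gcongr
    _ = 72 * (lam * √s₂ ^ 2) := by ring
    _ = 72 * (lam * s₂) := by rw [hss]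

end IsGPPLasso

end ErrorBound

section CovarianceMatrix

open scoped MatrixOrder

variable {n : ℕ} {S : Matrix (Fin n) (Fin n) ℝ}

theorem dotProduct_algebraMap_mulVec (r : ℝ) (v : Fin n → ℝ) :
    v ⬝ᵥ (algebraMap ℝ (Matrix (Fin n) (Fin n) ℝ) r *ᵥ v) = r * ∑ a, v a ^ 2 := by
  rw [Algebra.algebraMap_eq_smul_one, Matrix.smul_mulVec, Matrix.one_mulVec, dotProduct_smul,
    smul_eq_mul]
  simp only [dotProduct, sq]

theorem mul_sum_sq_le_dotProduct_mulVec (hS : S.IsHermitian) {c : ℝ}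
    (hspec : ∀ x ∈ spectrum ℝ S, c ≤ x) (v : Fin n → ℝ) :
    c * ∑ a, v a ^ 2 ≤ v ⬝ᵥ (S *ᵥ v) := by
  have hle := Matrix.le_iff.1 ((algebraMap_le_iff_le_spectrum hS).2 hspec)
  simpa [Matrix.sub_mulVec, dotProduct_algebraMap_mulVec] using hle.dotProduct_mulVec_nonneg v

theorem dotProduct_mulVec_le_mul_sum_sq (hS : S.IsHermitian) {c : ℝ}
    (hspec : ∀ x ∈ spectrum ℝ S, x ≤ c) (v : Fin n → ℝ) :
    v ⬝ᵥ (S *ᵥ v) ≤ c * ∑ a, v a ^ 2 := by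
  have hle := Matrix.le_iff.1 ((le_algebraMap_iff_spectrum_le hS).2 hspec)
  simpa [Matrix.sub_mulVec, dotProduct_algebraMap_mulVec] using hle.dotProduct_mulVec_nonneg v

theorem diag_le_of_spectrum_le (hS : S.IsHermitian) {c : ℝ} (hspec : ∀ x ∈ spectrum ℝ S, x ≤ c)
    (a : Fin n) : S a a ≤ c := by
  simpa [Pi.single_apply] using dotProduct_mulVec_le_mul_sum_sq hS hspec (Pi.single a 1)

theorem inv_mul_eq_one_of_le_spectrum {c : ℝ} (hc : 0 < c) (hspec : ∀ x ∈ spectrum ℝ S, c ≤ x) :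
    S⁻¹ * S = 1 :=
  Matrix.nonsing_inv_mul S <| (Matrix.isUnit_iff_isUnit_det S).1 <|
    (spectrum.zero_notMem_iff ℝ).1 fun h => absurd (hspec 0 h) hc.not_ge

theorem sum_sq_inv_row_le (hS : S.IsHermitian) {c : ℝ} (hc : 0 < c)
    (hspec : ∀ x ∈ spectrum ℝ S, c ≤ x) (a : Fin n) : ∑ b, S⁻¹ a b ^ 2 ≤ (1 / c) ^ 2 := by
  have hrow : S⁻¹ a ⬝ᵥ (S *ᵥ S⁻¹ a) = S⁻¹ a a := by
    have hunit : S⁻¹ a ᵥ* S = Pi.single a 1 := by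
      change (S⁻¹ * S) a = _
      rw [inv_mul_eq_one_of_le_spectrum hc hspec]
      exact funext fun _ => Matrix.one_eq_pi_single
    rw [Matrix.dotProduct_mulVec, hunit, single_one_dotProduct]
  have hlow : c * ∑ b, S⁻¹ a b ^ 2 ≤ S⁻¹ a a := by
    rw [← hrow]
    exact mul_sum_sq_le_dotProduct_mulVec hS hspec _
  have hdiag : S⁻¹ a a ^ 2 ≤ ∑ b, S⁻¹ a b ^ 2 :=
    Finset.single_le_sum (fun b _ => sq_nonneg (S⁻¹ a b)) (Finset.mem_univ a)
  rw [div_pow, one_pow, le_div_iff₀ (by positivity)]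
  nlinarith [sq_nonneg (c * S⁻¹ a a - 1)]

end CovarianceMatrix

section OneStep

variable {N n : ℕ} {Θ : Matrix (Fin n) (Fin n) ℝ} {X : Fin N → Fin n → ℝ} {j : Fin n}

theorem oneStepVar_eq (Θ : Matrix (Fin n) (Fin n) ℝ) (X : Fin N → Fin n → ℝ) (j : Fin n) :
    oneStepVar Θ X j = 1 / (N : ℝ) * ∑ i, (Matrix.of X *ᵥ Θ j) i ^ 2 := by
  simp only [sq]
  change _ = 1 / (N : ℝ) * (Matrix.of X *ᵥ Θ j) ⬝ᵥ (Matrix.of X *ᵥ Θ j)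
  rw [← dotProduct_sampleCov_mulVec, Matrix.dotProduct_mulVec]
  rfl

theorem oneStepVar_nonneg (Θ : Matrix (Fin n) (Fin n) ℝ) (X : Fin N → Fin n → ℝ) (j : Fin n) :
    0 ≤ oneStepVar Θ X j := by
  rw [oneStepVar_eq]
  positivity

theorem sampleCov_apply (X : Fin N → Fin n → ℝ) (a b : Fin n) :
    sampleCov X a b = 1 / (N : ℝ) * ∑ i, X i a * X i b := by
  rw [sampleCov, Matrix.smul_apply, smul_eq_mul, Matrix.mul_apply]
  rfl

theorem mul_sampleCov_apply (Θ : Matrix (Fin n) (Fin n) ℝ) (X : Fin N → Fin n → ℝ)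
    (a b : Fin n) :
    (Θ * sampleCov X) a b = 1 / (N : ℝ) * ∑ i, (Matrix.of X *ᵥ Θ a) i * X i b := by
  have h := dotProduct_sampleCov_mulVec X (Θ a) (Pi.single b 1)
  rwa [Matrix.mulVec_single_one, Matrix.mulVec_single_one] at h

theorem one_sub_sq_le_oneStepVar_mul {mu : ℝ} (hΘ : Θ ∈ climeFeasible (sampleCov X) mu)
    (hmu : mu ≤ 1) (j : Fin n) : (1 - mu) ^ 2 ≤ oneStepVar Θ X j * sampleCov X j j := by
  have hjj : 1 - mu ≤ (Θ * sampleCov X) j j := by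
    have h := hΘ j j
    rw [Matrix.sub_apply, Matrix.one_apply_eq] at h
    linarith [neg_le_of_abs_le h]
  calc (1 - mu) ^ 2 ≤ (Θ * sampleCov X) j j ^ 2 := pow_le_pow_left₀ (by linarith) hjj 2
    _ = (1 / (N : ℝ)) ^ 2 * (∑ i, (Matrix.of X *ᵥ Θ j) i * X i j) ^ 2 := by
        rw [mul_sampleCov_apply, mul_pow]
    _ ≤ (1 / (N : ℝ)) ^ 2 * ((∑ i, (Matrix.of X *ᵥ Θ j) i ^ 2) * ∑ i, X i j ^ 2) := by
        gcongr
        exact Finset.sum_mul_sq_le_sq_mul_sq _ _ _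
    _ = oneStepVar Θ X j * sampleCov X j j := by
        simp only [oneStepVar_eq, sampleCov_apply, ← sq]
        ring

theorem one_le_two_mul_sqrt_mul_sqrt_oneStepVar {mu K : ℝ}
    (hΘ : Θ ∈ climeFeasible (sampleCov X) mu) (hmu : mu ≤ 1 / 2) (hK : sampleCov X j j ≤ K) :
    1 ≤ 2 * (√K * √(oneStepVar Θ X j)) := by
  have hV := oneStepVar_nonneg Θ X j
  have h : (1 / 2) ^ 2 ≤ K * oneStepVar Θ X j := calc
    (1 / 2 : ℝ) ^ 2 ≤ (1 - mu) ^ 2 := by gcongr; linarith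
    _ ≤ oneStepVar Θ X j * sampleCov X j j := one_sub_sq_le_oneStepVar_mul hΘ (by linarith) j
    _ ≤ oneStepVar Θ X j * K := by gcongr
    _ = K * oneStepVar Θ X j := mul_comm _ _
  rw [← Real.sqrt_mul' _ hV]
  linarith [Real.le_sqrt_of_sq_le h]

theorem oneStep_response_sub (Θ : Matrix (Fin n) (Fin n) ℝ) (X : Fin N → Fin n → ℝ)
    (β b : Fin n → ℝ) (ε : Fin N → ℝ) :
    oneStep Θ X (response X β ε) b - β
      = Θ *ᵥ noiseScore X ε - (Θ * sampleCov X - 1) *ᵥ (b - β) := by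
  have hres : response X β ε - Matrix.of X *ᵥ b = ε - Matrix.of X *ᵥ (b - β) := by
    rw [response, Matrix.mulVec_sub]
    abel
  rw [oneStep, hres, noiseScore, sampleCov, Matrix.sub_mulVec, Matrix.one_mulVec,
    ← Matrix.mulVec_mulVec, Matrix.smul_mulVec, ← Matrix.mulVec_mulVec, Matrix.mulVec_sub,
    Matrix.mulVec_sub, Matrix.mulVec_smul, Matrix.mulVec_smul, smul_sub]
  abel

/-- The error `b - β` of an estimator with asymptotic variance `τ² V`, scaled by its standard
deviation. It is the junk value `0` if `V ≤ 0`. -/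
noncomputable def studentizedError (N τ V b β : ℝ) : ℝ := √N * (b - β) / (τ * √V)

/-- The unit vector of weights with which the noise enters the one-step estimator of the `j`-th
coefficient. If the variance factor vanishes, it is replaced by an arbitrary constant unit vector,
so that the weighted noise always has the same law. -/
noncomputable def oneStepWeights (Θ : Matrix (Fin n) (Fin n) ℝ) (X : Fin N → Fin n → ℝ)
    (j : Fin n) : Fin N → ℝ :=
  open Classical in
  if 0 < oneStepVar Θ X j then (√N * √(oneStepVar Θ X j))⁻¹ • (Matrix.of X *ᵥ Θ j)
  else fun _ => (√N)⁻¹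

theorem sum_sq_oneStepWeights (hN : 0 < N) (Θ : Matrix (Fin n) (Fin n) ℝ)
    (X : Fin N → Fin n → ℝ) (j : Fin n) : ∑ i, oneStepWeights Θ X j i ^ 2 = 1 := by
  have hN' : (0 : ℝ) < N := Nat.cast_pos.2 hN
  rw [oneStepWeights]
  split_ifs with hV
  · simp only [Pi.smul_apply, smul_eq_mul, mul_pow, ← Finset.mul_sum, inv_pow,
      Real.sq_sqrt hN'.le, Real.sq_sqrt hV.le]
    rw [inv_mul_eq_one₀ (by positivity), oneStepVar_eq]
    field_simp
  · simp [Real.sq_sqrt hN'.le, hN'.ne']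

theorem studentizedError_oneStep_sub (hN : 0 < N) {τ : ℝ} (hτ : 0 < τ)
    (hV : 0 < oneStepVar Θ X j) (β b : Fin n → ℝ) (ε : Fin N → ℝ) :
    studentizedError N τ (oneStepVar Θ X j) (oneStep Θ X (response X β ε) b j) (β j)
        - oneStepWeights Θ X j ⬝ᵥ ε / τ
      = -(√N * ((Θ * sampleCov X - 1) j ⬝ᵥ (b - β)) / (τ * √(oneStepVar Θ X j))) := by
  have := Real.sqrt_pos.2 (Nat.cast_pos.2 hN : (0 : ℝ) < N)
  have := Real.sqrt_pos.2 hV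
  have herr : oneStep Θ X (response X β ε) b j - β j
      = 1 / (√(N : ℝ)) ^ 2 * (Matrix.of X *ᵥ Θ j) ⬝ᵥ ε
        - (Θ * sampleCov X - 1) j ⬝ᵥ (b - β) := by
    rw [Real.sq_sqrt (Nat.cast_nonneg _), ← dotProduct_noiseScore]
    exact congrFun (oneStep_response_sub Θ X β b ε) j
  rw [studentizedError, oneStepWeights, if_pos hV, smul_dotProduct, smul_eq_mul, herr]
  field_simp
  ring

theorem abs_studentizedError_oneStep_sub_le (hN : 0 < N) {τ mu K L : ℝ} (hτ : 0 < τ)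
    (hΘ : Θ ∈ climeFeasible (sampleCov X) mu) (hmu : mu ≤ 1 / 2) (hK : sampleCov X j j ≤ K)
    {β b : Fin n → ℝ} (hL : vecL1 (b - β) ≤ L) (ε : Fin N → ℝ) :
    0 < oneStepVar Θ X j ∧
      |studentizedError N τ (oneStepVar Θ X j) (oneStep Θ X (response X β ε) b j) (β j)
        - oneStepWeights Θ X j ⬝ᵥ ε / τ| ≤ 2 * √K * (√N * (mu * L)) / τ := by
  have hsV := one_le_two_mul_sqrt_mul_sqrt_oneStepVar hΘ hmu hK
  have hsV0 : 0 < √(oneStepVar Θ X j) := by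
    by_contra! h
    nlinarith [Real.sqrt_nonneg K]
  have hmu0 : 0 ≤ mu := (abs_nonneg _).trans (hΘ j j)
  have hL0 : 0 ≤ L := (Finset.sum_nonneg fun _ _ => abs_nonneg _).trans hL
  have bias : |(Θ * sampleCov X - 1) j ⬝ᵥ (b - β)| ≤ mu * L :=
    (abs_dotProduct_le_mul_vecL1 (hΘ j)).trans (by gcongr)
  refine ⟨Real.sqrt_pos.1 hsV0, ?_⟩
  rw [studentizedError_oneStep_sub hN hτ (Real.sqrt_pos.1 hsV0), abs_neg, abs_div, abs_mul,
    abs_of_nonneg (Real.sqrt_nonneg _), abs_of_pos (by positivity : 0 < τ * _),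
    div_le_div_iff₀ (by positivity) hτ]
  calc √N * |(Θ * sampleCov X - 1) j ⬝ᵥ (b - β)| * τ ≤ √N * (mu * L) * τ * 1 := by
        rw [mul_one]
        gcongr
    _ ≤ √N * (mu * L) * τ * (2 * (√K * √(oneStepVar Θ X j))) := by gcongr
    _ = 2 * √K * (√N * (mu * L)) * (τ * √(oneStepVar Θ X j)) := by ring

theorem measurable_mulVec_row {Θhat : (Fin N → Fin n → ℝ) → Fin n → Fin n → ℝ}
    (hΘ : Measurable Θhat) (j : Fin n) :
    Measurable fun x : Fin N → Fin n → ℝ => Matrix.of x *ᵥ Θhat x j := by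
  refine measurable_pi_lambda _ fun i => ?_
  simp only [Matrix.mulVec, dotProduct, Matrix.of_apply]
  fun_prop

theorem measurable_oneStepVar {Θhat : (Fin N → Fin n → ℝ) → Fin n → Fin n → ℝ}
    (hΘ : Measurable Θhat) (j : Fin n) :
    Measurable fun x : Fin N → Fin n → ℝ => oneStepVar (Matrix.of (Θhat x)) x j := by
  simp only [oneStepVar_eq]
  exact (Finset.measurable_sum _ fun i _ =>
    ((measurable_pi_apply i).comp (measurable_mulVec_row hΘ j)).pow_const 2).const_mul _

theorem measurable_oneStepWeights {Θhat : (Fin N → Fin n → ℝ) → Fin n → Fin n → ℝ}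
    (hΘ : Measurable Θhat) (j : Fin n) :
    Measurable fun x : Fin N → Fin n → ℝ => oneStepWeights (Matrix.of (Θhat x)) x j := by
  have hV := measurable_oneStepVar hΘ j
  unfold oneStepWeights
  exact .ite (measurableSet_lt measurable_const hV)
    ((hV.sqrt.const_mul _).inv.smul (measurable_mulVec_row hΘ j)) measurable_const

theorem measurable_oneStep_apply {Ω : Type*} [MeasurableSpace Ω] {X : Ω → Fin N → Fin n → ℝ}
    {ε : Ω → Fin N → ℝ} {βhat : Ω → Fin n → ℝ} {Θhat : Ω → Fin n → Fin n → ℝ}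
    (hX : Measurable X) (hε : Measurable ε) (hb : Measurable βhat) (hΘ : Measurable Θhat)
    (β : Fin n → ℝ) (j : Fin n) :
    Measurable fun ω => oneStep (Matrix.of (Θhat ω)) (X ω) (response (X ω) β (ε ω))
      (βhat ω) j := by
  simp only [oneStep, response, Matrix.mulVec, dotProduct, Pi.add_apply, Pi.smul_apply,
    Pi.sub_apply, Matrix.of_apply, Matrix.transpose_apply, smul_eq_mul]
  fun_prop

end OneStep

section GaussianNoise

variable {Ω ι : Type*} [MeasurableSpace Ω] {P : Measure Ω}

theorem iIndepFun_prodMk_of_indepFun [Finite ι] [IsProbabilityMeasure P] {Y Z : ι → Ω → ℝ}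
    (hYm : ∀ i, Measurable (Y i)) (hZm : ∀ i, Measurable (Z i)) (hY : iIndepFun Y P)
    (hZ : iIndepFun Z P) (hYZ : IndepFun (fun ω i => Y i ω) (fun ω i => Z i ω) P) :
    iIndepFun (fun i ω => (Y i ω, Z i ω)) P := by
  have := Fintype.ofFinite ι
  have hY' : Measurable (fun ω i => Y i ω) := measurable_pi_lambda _ hYm
  have hZ' : Measurable (fun ω i => Z i ω) := measurable_pi_lambda _ hZm
  have := fun i => Measure.isProbabilityMeasure_map (μ := P) (hYm i).aemeasurable
  have := fun i => Measure.isProbabilityMeasure_map (μ := P) (hZm i).aemeasurable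
  have law_pair : ∀ i, P.map (fun ω => (Y i ω, Z i ω)) = (P.map (Y i)).prod (P.map (Z i)) :=
    fun i => (indepFun_iff_map_prod_eq_prod_map_map (hYm i).aemeasurable (hZm i).aemeasurable).1
      (hYZ.comp (measurable_pi_apply i) (measurable_pi_apply i))
  have law_joint : P.map (fun ω => (fun i => Y i ω, fun i => Z i ω))
      = (Measure.pi fun i => P.map (Y i)).prod (Measure.pi fun i => P.map (Z i)) := by
    rw [← hY.map_fun_eq_pi_map fun i => (hYm i).aemeasurable,
      ← hZ.map_fun_eq_pi_map fun i => (hZm i).aemeasurable]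
    exact (indepFun_iff_map_prod_eq_prod_map_map hY'.aemeasurable hZ'.aemeasurable).1 hYZ
  have swap := (measurePreserving_arrowProdEquivProdArrow ℝ ℝ ι (fun i => P.map (Y i))
    (fun i => P.map (Z i))).symm
  rw [iIndepFun_iff_map_fun_eq_pi_map fun i => ((hYm i).prodMk (hZm i)).aemeasurable]
  simp only [law_pair]
  rw [← swap.map_eq, ← law_joint, Measure.map_map swap.measurable (hY'.prodMk hZ')]
  rfl

theorem map_eq_of_indepFun_of_forall_map_eq {α β γ : Type*} [MeasurableSpace α]
    [MeasurableSpace β] [MeasurableSpace γ] [IsProbabilityMeasure P] {X : Ω → α} {Y : Ω → β}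
    (hX : Measurable X) (hY : Measurable Y) (hXY : IndepFun X Y P) {f : α → β → γ}
    (hf : Measurable (Function.uncurry f)) {m : Measure γ}
    (hlaw : ∀ x, P.map (fun ω => f x (Y ω)) = m) : P.map (fun ω => f (X ω) (Y ω)) = m := by
  have := Measure.isProbabilityMeasure_map (μ := P) hX.aemeasurable
  have := Measure.isProbabilityMeasure_map (μ := P) hY.aemeasurable
  have law : P.map (fun ω => f (X ω) (Y ω))
      = ((P.map X).prod (P.map Y)).map (Function.uncurry f) := by
    rw [← (indepFun_iff_map_prod_eq_prod_map_map hX.aemeasurable hY.aemeasurable).1 hXY,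
      Measure.map_map hf (hX.prodMk hY)]
    rfl
  rw [law]
  ext A hA
  rw [Measure.map_apply hf hA, Measure.prod_apply (hf hA)]
  have slice : ∀ x, P.map Y (Prod.mk x ⁻¹' (Function.uncurry f ⁻¹' A)) = m A := fun x => by
    have hfY : Measurable fun ω => f x (Y ω) := hf.comp (measurable_prodMk_left.comp hY)
    rw [← hlaw x, Measure.map_apply hY (measurable_prodMk_left (hf hA)),
      Measure.map_apply hfY hA]
    rfl
  simp only [slice, lintegral_const, measure_univ, mul_one]

theorem map_sum_eq_gaussianReal [Fintype ι] [IsProbabilityMeasure P] {Z : ι → Ω → ℝ}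
    {v : ι → NNReal} (hZm : ∀ i, Measurable (Z i)) (hZ : iIndepFun Z P)
    (hlaw : ∀ i, P.map (Z i) = gaussianReal 0 (v i)) :
    P.map (fun ω => ∑ i, Z i ω) = gaussianReal 0 (∑ i, v i) := by
  have := Measure.isProbabilityMeasure_map (μ := P)
    (Finset.measurable_sum Finset.univ fun i _ => hZm i).aemeasurable
  refine Measure.ext_of_charFun (funext fun t => ?_)
  rw [iIndepFun.charFun_map_fun_sum_eq_prod (fun i => (hZm i).aemeasurable) hZ, Finset.prod_apply]
  simp only [hlaw, charFun_gaussianReal, ← Complex.exp_sum]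
  congr 1
  push_cast
  simp only [mul_zero, zero_mul, zero_sub, Finset.sum_neg_distrib, Finset.sum_div, Finset.sum_mul]

theorem hasSubgaussianMGF_of_map_eq_gaussianReal {Z : Ω → ℝ} (hZm : Measurable Z) {v : NNReal}
    (h : P.map Z = gaussianReal 0 v) : HasSubgaussianMGF Z v P := by
  refine (HasSubgaussianMGF.id_map_iff hZm.aemeasurable).1 ?_
  rw [h]
  exact ⟨fun t => integrable_exp_mul_gaussianReal t, fun t => by simp [mgf_id_gaussianReal]⟩

namespace IsGaussianNoise

variable {N : ℕ} {τ : ℝ} {ε : Ω → Fin N → ℝ}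

theorem measurable_apply (hε : IsGaussianNoise τ ε P) (i : Fin N) : Measurable fun ω => ε ω i :=
  (measurable_pi_apply i).comp hε.measurable

theorem map_dotProduct_div [IsProbabilityMeasure P] (hτ : 0 < τ) (hε : IsGaussianNoise τ ε P)
    {a : Fin N → ℝ} (ha : ∑ i, a i ^ 2 = 1) :
    P.map (fun ω => a ⬝ᵥ ε ω / τ) = gaussianReal 0 1 := by
  have scaled : ∀ i, P.map (fun ω => a i / τ * ε ω i)
      = gaussianReal 0 (a i ^ 2).toNNReal := fun i => by
    have law := (gaussianReal_const_mul ⟨(hε.measurable_apply i).aemeasurable, hε.law i⟩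
      (a i / τ)).map_eq
    rw [law, mul_zero]
    congr 1
    ext
    simp only [NNReal.coe_mul, NNReal.coe_mk, Real.coe_toNNReal _ (sq_nonneg _)]
    field_simp
  have total : ∑ i, (a i ^ 2).toNNReal = 1 := by
    rw [← Real.toNNReal_sum_of_nonneg fun i _ => sq_nonneg (a i), ha, Real.toNNReal_one]
  have h := map_sum_eq_gaussianReal (fun i => (hε.measurable_apply i).const_mul (a i / τ))
    (hε.indep.comp (fun i x => a i / τ * x) fun i => by fun_prop) scaled
  rw [total] at h
  rw [← h]
  congr 1
  ext ω
  simp only [dotProduct, Finset.sum_div]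
  exact Finset.sum_congr rfl fun i _ => by ring

theorem map_comp_dotProduct_div [IsProbabilityMeasure P] (hτ : 0 < τ)
    (hε : IsGaussianNoise τ ε P) {E : Type*} [MeasurableSpace E] {X : Ω → E} (hX : Measurable X)
    (hXε : IndepFun X ε P) {u : E → Fin N → ℝ} (hu : Measurable u)
    (hu1 : ∀ x, ∑ i, u x i ^ 2 = 1) :
    P.map (fun ω => u (X ω) ⬝ᵥ ε ω / τ) = gaussianReal 0 1 := by
  refine map_eq_of_indepFun_of_forall_map_eq hX hε.measurable hXε
    (f := fun x e => u x ⬝ᵥ e / τ) ?_ fun x => map_dotProduct_div hτ hε (hu1 x)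
  refine Measurable.div_const (Finset.measurable_sum _ fun i _ => ?_) τ
  exact ((measurable_pi_apply i).comp (hu.comp measurable_fst)).mul
    ((measurable_pi_apply i).comp measurable_snd)

end IsGaussianNoise

end GaussianNoise

section SubgaussianDesign

variable {Ω : Type*} [MeasurableSpace Ω] {P : Measure Ω}

theorem hasSubgaussianMGF_of_le {Z : Ω → ℝ} {v w : NNReal} (hZ : HasSubgaussianMGF Z v P)
    (hvw : v ≤ w) : HasSubgaussianMGF Z w P :=
  ⟨hZ.integrable_exp_mul, fun t => (hZ.mgf_le t).trans (by gcongr)⟩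

namespace IsSubGaussianVec

variable {n : ℕ} {σ : ℝ} {V : Ω → Fin n → ℝ}

theorem hasSubgaussianMGF_dotProduct [IsProbabilityMeasure P] (hV : IsSubGaussianVec σ V P)
    {v : Fin n → ℝ} {r : ℝ} (hv : ∑ a, v a ^ 2 ≤ r ^ 2) :
    HasSubgaussianMGF (fun ω => v ⬝ᵥ V ω) ((σ * r) ^ 2).toNNReal P := by
  set Q := ∑ a, v a ^ 2
  have hQ0 : 0 ≤ Q := Finset.sum_nonneg fun _ _ => sq_nonneg _
  rcases hQ0.eq_or_lt with h | h
  · have v_eq_zero : v = 0 := funext fun a => pow_eq_zero_iff two_ne_zero |>.1 <|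
      (Finset.sum_eq_zero_iff_of_nonneg fun a _ => sq_nonneg (v a)).1 h.symm a (Finset.mem_univ a)
    simpa only [v_eq_zero, zero_dotProduct] using
      hasSubgaussianMGF_of_le HasSubgaussianMGF.fun_zero zero_le
  · have unit : ∑ a, ((√Q)⁻¹ • v) a ^ 2 = 1 := by
      simp only [Pi.smul_apply, smul_eq_mul, mul_pow, ← Finset.mul_sum, inv_pow, Real.sq_sqrt hQ0]
      exact inv_mul_cancel₀ h.ne'
    have scaled := (hV.2 _ unit).2.const_mul √Q
    simp only [smul_dotProduct, smul_eq_mul,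
      mul_inv_cancel_left₀ (Real.sqrt_pos.2 h).ne'] at scaled
    have parameter_le : √Q ^ 2 * ((σ ^ 2).toNNReal : ℝ) ≤ ((σ * r) ^ 2).toNNReal := by
      rw [Real.coe_toNNReal _ (sq_nonneg _), Real.coe_toNNReal _ (sq_nonneg _),
        Real.sq_sqrt hQ0, mul_pow, mul_comm]
      gcongr
    exact hasSubgaussianMGF_of_le scaled parameter_le

theorem hasSubgaussianMGF_apply (hV : IsSubGaussianVec σ V P) (a : Fin n) :
    HasSubgaussianMGF (fun ω => V ω a) (σ ^ 2).toNNReal P := by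
  simpa using (hV.2 (Pi.single a 1) (by simp [Pi.single_apply])).2

end IsSubGaussianVec

namespace IsRowwiseSubGaussian

variable {N n : ℕ} {σ : ℝ} {S : Matrix (Fin n) (Fin n) ℝ} {X : Ω → Fin N → Fin n → ℝ}

theorem measurable_apply (hX : IsRowwiseSubGaussian σ S X P) (i : Fin N) (a : Fin n) :
    Measurable fun ω => X ω i a :=
  (measurable_pi_apply a).comp ((measurable_pi_apply i).comp hX.measurable)

theorem isHermitian (hX : IsRowwiseSubGaussian σ S X P) (hN : 0 < N) : S.IsHermitian := by
  ext a b
  rw [Matrix.conjTranspose_apply, star_trivial, ← hX.covariance_eq ⟨0, hN⟩ b a,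
    ← hX.covariance_eq ⟨0, hN⟩ a b, covariance_comm]

theorem integral_mul (hX : IsRowwiseSubGaussian σ S X P) (i : Fin N) (a b : Fin n) :
    ∫ ω, X ω i a * X ω i b ∂P = S a b := by
  rw [← hX.covariance_eq i a b, covariance]
  simp only [((hX.subGaussian i).1 a).2, ((hX.subGaussian i).1 b).2, sub_zero]

theorem integral_dotProduct_mul [IsFiniteMeasure P] (hX : IsRowwiseSubGaussian σ S X P)
    (i : Fin N) (v : Fin n → ℝ) (b : Fin n) :
    ∫ ω, (v ⬝ᵥ X ω i) * X ω i b ∂P = (v ᵥ* S) b := by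
  have memLp : ∀ a, MemLp (fun ω => X ω i a) 2 P := fun a =>
    ((hX.subGaussian i).hasSubgaussianMGF_apply a).memLp 2
  have integrable : ∀ a, Integrable (fun ω => X ω i a * X ω i b) P := fun a =>
    (memLp a).integrable_mul (memLp b)
  simp only [dotProduct, Finset.sum_mul, Matrix.vecMul, mul_assoc]
  rw [integral_finsetSum _ fun a _ => (integrable a).const_mul _]
  exact Finset.sum_congr rfl fun a _ => by rw [integral_const_mul, hX.integral_mul]

end IsRowwiseSubGaussian

end SubgaussianDesign

section RegularSample

/-- The deterministic conditions on the design and the noise under which the estimation error is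
controlled: the sample covariance matrix is entrywise within `κ` of `S`, the population precision
matrix `S⁻¹` is feasible for the CLIME program of level `η`, and the noise score is at most `ξ`. -/
structure IsRegularSample {N n : ℕ} (κ η ξ : ℝ) (S : Matrix (Fin n) (Fin n) ℝ)
    (X : Fin N → Fin n → ℝ) (ε : Fin N → ℝ) : Prop where
  cov_close : ∀ a b, |(sampleCov X - S) a b| ≤ κ
  inv_feasible : S⁻¹ ∈ climeFeasible (sampleCov X) η
  score_le : ∀ a, |noiseScore X ε a| ≤ ξ

variable {Ω : Type*} [MeasurableSpace Ω] {P : Measure Ω}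

theorem measureReal_exists_le {ι : Type*} [Fintype ι] {p : ι → Ω → Prop} {q : ℝ}
    (h : ∀ i, P.real {ω | p i ω} ≤ q) : P.real {ω | ∃ i, p i ω} ≤ Fintype.card ι * q := by
  rw [Set.ofPred_exists]
  refine (measureReal_iUnion_fintype_le _).trans ((Finset.sum_le_sum fun i _ => h i).trans ?_)
  simp

variable [IsProbabilityMeasure P] {N n : ℕ} {σ τ ρ : ℝ} {S : Matrix (Fin n) (Fin n) ℝ}
  {X : Ω → Fin N → Fin n → ℝ} {ε : Ω → Fin N → ℝ}

namespace IsRowwiseSubGaussian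

theorem measureReal_lt_abs_average_dotProduct_mul_sub_le (hX : IsRowwiseSubGaussian σ S X P)
    (hN : 0 < N) (hσ : 0 < σ) {v : Fin n → ℝ} {r : ℝ} (hr : 0 < r) (hv : ∑ a, v a ^ 2 ≤ r ^ 2)
    (b : Fin n) (hρ : 0 ≤ ρ) (hρ' : ρ ≤ 1 / 2) :
    P.real {ω | 36 * (σ * r * σ) * ρ < |1 / (N : ℝ) * ∑ i, (v ⬝ᵥ X ω i) * X ω i b - (v ᵥ* S) b|}
      ≤ 2 * Real.exp (-(4 * (N * ρ ^ 2))) := by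
  have hdot : Measurable fun x : Fin n → ℝ => v ⬝ᵥ x :=
    Finset.measurable_sum _ fun a _ => (measurable_pi_apply a).const_mul _
  exact measureReal_lt_abs_average_mul_sub_le hN (mul_pos hσ hr) hσ
    (fun i => hdot.comp ((measurable_pi_apply i).comp hX.measurable))
    (fun i => hX.measurable_apply i b)
    (fun i => (hX.subGaussian i).hasSubgaussianMGF_dotProduct hv)
    (fun i => (hX.subGaussian i).hasSubgaussianMGF_apply b)
    (hX.indep.comp (fun _ x => (v ⬝ᵥ x) * x b) fun _ => hdot.mul (measurable_pi_apply b))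
    (fun i => hX.integral_dotProduct_mul i v b) hρ hρ'

theorem measureReal_lt_abs_sampleCov_sub_le (hX : IsRowwiseSubGaussian σ S X P) (hN : 0 < N)
    (hσ : 0 < σ) (hρ : 0 ≤ ρ) (hρ' : ρ ≤ 1 / 2) (a b : Fin n) :
    P.real {ω | 36 * σ ^ 2 * ρ < |(sampleCov (X ω) - S) a b|}
      ≤ 2 * Real.exp (-(4 * (N * ρ ^ 2))) := by
  have h := hX.measureReal_lt_abs_average_dotProduct_mul_sub_le hN hσ (v := Pi.single a 1)
    one_pos (by simp [Pi.single_apply]) b hρ hρ'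
  simpa only [single_dotProduct, one_mul, mul_one, Matrix.single_one_vecMul, Matrix.row_apply,
    Matrix.sub_apply, sampleCov_apply, ← sq] using h

theorem measureReal_lt_abs_inv_mul_sampleCov_sub_one_le (hX : IsRowwiseSubGaussian σ S X P)
    (hN : 0 < N) (hσ : 0 < σ) {c : ℝ} (hc : 0 < c) (hS : ∀ x ∈ spectrum ℝ S, c ≤ x)
    (hρ : 0 ≤ ρ) (hρ' : ρ ≤ 1 / 2) (a b : Fin n) :
    P.real {ω | 36 * σ ^ 2 / c * ρ < |(S⁻¹ * sampleCov (X ω) - 1) a b|}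
      ≤ 2 * Real.exp (-(4 * (N * ρ ^ 2))) := by
  have h := hX.measureReal_lt_abs_average_dotProduct_mul_sub_le hN hσ (one_div_pos.2 hc)
    (sum_sq_inv_row_le (hX.isHermitian hN) hc hS a) b hρ hρ'
  have row_mul : (S⁻¹ a ᵥ* S) b = (1 : Matrix (Fin n) (Fin n) ℝ) a b := by
    rw [← inv_mul_eq_one_of_le_spectrum hc hS]
    rfl
  have scale : 36 * (σ * (1 / c) * σ) = 36 * σ ^ 2 / c := by ring
  simpa only [Matrix.sub_apply, mul_sampleCov_apply, row_mul, scale, Matrix.mulVec,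
    Matrix.of_apply, dotProduct_comm] using h

theorem measureReal_lt_abs_noiseScore_le (hX : IsRowwiseSubGaussian σ S X P)
    (hε : IsGaussianNoise τ ε P) (hXε : IndepFun X ε P) (hN : 0 < N) (hσ : 0 < σ) (hτ : 0 < τ)
    (hρ : 0 ≤ ρ) (hρ' : ρ ≤ 1 / 2) (a : Fin n) :
    P.real {ω | 36 * (σ * τ) * ρ < |noiseScore (X ω) (ε ω) a|}
      ≤ 2 * Real.exp (-(4 * (N * ρ ^ 2))) := by
  have column : Measurable fun (x : Fin N → Fin n → ℝ) (i : Fin N) => x i a :=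
    measurable_pi_lambda _ fun i => (measurable_pi_apply a).comp (measurable_pi_apply i)
  have indep : iIndepFun (fun i ω => X ω i a * ε ω i) P :=
    (iIndepFun_prodMk_of_indepFun (fun i => hX.measurable_apply i a) hε.measurable_apply
      (hX.indep.comp (fun _ x => x a) fun _ => measurable_pi_apply a) hε.indep
      (hXε.comp column measurable_id)).comp (fun _ p => p.1 * p.2)
      fun _ => measurable_fst.mul measurable_snd
  have mean_zero : ∀ i, ∫ ω, X ω i a * ε ω i ∂P = 0 := fun i => by
    have : IndepFun (fun ω => X ω i a) (fun ω => ε ω i) P :=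
      hXε.comp ((measurable_pi_apply i).comp column) (measurable_pi_apply i)
    rw [this.integral_fun_mul_eq_mul_integral (hX.measurable_apply i a).aestronglyMeasurable
      (hε.measurable_apply i).aestronglyMeasurable, ((hX.subGaussian i).1 a).2, zero_mul]
  have h := measureReal_lt_abs_average_mul_sub_le hN hσ hτ (fun i => hX.measurable_apply i a)
    hε.measurable_apply (fun i => (hX.subGaussian i).hasSubgaussianMGF_apply a)
    (fun i => hasSubgaussianMGF_of_map_eq_gaussianReal (hε.measurable_apply i) (hε.law i))
    indep mean_zero hρ hρ'
  simp only [sub_zero] at h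
  exact h

theorem measureReal_not_isRegularSample_le (hX : IsRowwiseSubGaussian σ S X P)
    (hε : IsGaussianNoise τ ε P) (hXε : IndepFun X ε P) (hN : 0 < N) (hσ : 0 < σ) (hτ : 0 < τ)
    {c : ℝ} (hc : 0 < c) (hS : ∀ x ∈ spectrum ℝ S, c ≤ x) (hρ : 0 ≤ ρ) (hρ' : ρ ≤ 1 / 2) :
    P.real {ω | ¬ IsRegularSample (36 * σ ^ 2 * ρ) (36 * σ ^ 2 / c * ρ) (36 * (σ * τ) * ρ) S
      (X ω) (ε ω)} ≤ 6 * n ^ 2 * Real.exp (-(4 * (N * ρ ^ 2))) := by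
  set q := 2 * Real.exp (-(4 * (N * ρ ^ 2))) with hq
  have cov := measureReal_exists_le fun p : Fin n × Fin n =>
    hX.measureReal_lt_abs_sampleCov_sub_le hN hσ hρ hρ' p.1 p.2
  have inv := measureReal_exists_le fun p : Fin n × Fin n =>
    hX.measureReal_lt_abs_inv_mul_sampleCov_sub_one_le hN hσ hc hS hρ hρ' p.1 p.2
  have score := measureReal_exists_le fun a =>
    hX.measureReal_lt_abs_noiseScore_le hε hXε hN hσ hτ hρ hρ' a
  rw [Fintype.card_prod, Fintype.card_fin, Nat.cast_mul] at cov inv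
  rw [Fintype.card_fin] at score
  have score' : (n : ℝ) * q ≤ n * n * q := by
    have : (n : ℝ) ≤ n * n := by exact_mod_cast Nat.le_mul_self n
    gcongr
  have union := (measureReal_union_le (μ := P) _ _).trans
    (add_le_add cov ((measureReal_union_le _ _).trans (add_le_add inv score)))
  refine (measureReal_mono fun ω hω => ?_).trans (union.trans ?_)
  · by_contra hcon
    simp only [Set.mem_union, Set.mem_ofPred_eq, not_or, not_exists, not_lt, Prod.forall] at hcon
    exact hω ⟨hcon.1, hcon.2.1, hcon.2.2⟩
  · calc _ ≤ (n : ℝ) * n * q + (n * n * q + n * n * q) := by gcongr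
      _ = _ := by rw [hq]; ring

end IsRowwiseSubGaussian

end RegularSample

section NearLaw

/-- `T` is within distance `r`, outside an event of probability at most `p`, of a random variable
on the same probability space whose law is `γ`. -/
def IsNearLaw {Ω E : Type*} [MeasurableSpace Ω] [MeasurableSpace E] [PseudoMetricSpace E]
    (r p : ℝ) (T : Ω → E) (γ : Measure E) (P : Measure Ω) : Prop :=
  ∃ W : Ω → E, HasLaw W γ P ∧ P.real {ω | r < dist (T ω) (W ω)} ≤ p

variable {E : Type*} [MeasurableSpace E] [PseudoMetricSpace E] [BorelSpace E]

theorem integrable_comp_of_lipschitzWith_of_dist_le {Ω : Type*} [MeasurableSpace Ω]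
    {P : Measure Ω} [IsFiniteMeasure P] {f : E → ℝ} {L : NNReal} {C : ℝ} (hL : LipschitzWith L f)
    (hC : ∀ x y, dist (f x) (f y) ≤ C) {T : Ω → E} (hT : AEMeasurable T P) :
    Integrable (fun ω => f (T ω)) P := by
  rcases isEmpty_or_nonempty Ω with hΩ | ⟨⟨ω₀⟩⟩
  · rw [Measure.eq_zero_of_isEmpty P]
    exact integrable_zero_measure
  · refine Integrable.of_bound (hL.continuous.measurable.comp_aemeasurable hT).aestronglyMeasurable
      (C + ‖f (T ω₀)‖) (Eventually.of_forall fun ω => ?_)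
    have := norm_le_norm_add_norm_sub' (f (T ω)) (f (T ω₀))
    linarith [hC (T ω) (T ω₀), dist_eq_norm (f (T ω)) (f (T ω₀))]

theorem abs_integral_comp_sub_integral_comp_le [SecondCountableTopology E] {Ω : Type*}
    [MeasurableSpace Ω] {P : Measure Ω} [IsProbabilityMeasure P] {f : E → ℝ} {L : NNReal} {C : ℝ}
    (hL : LipschitzWith L f) (hC : ∀ x y, dist (f x) (f y) ≤ C) {T W : Ω → E}
    (hT : AEMeasurable T P) (hW : AEMeasurable W P) {r : ℝ} (hr : 0 ≤ r) :
    |∫ ω, f (T ω) ∂P - ∫ ω, f (W ω) ∂P| ≤ L * r + P.real {ω | r < dist (T ω) (W ω)} * C := by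
  set B : Set Ω := {ω | r < dist (T ω) (W ω)}
  have hB : NullMeasurableSet B P := nullMeasurableSet_lt aemeasurable_const (hT.dist hW)
  have hfT := integrable_comp_of_lipschitzWith_of_dist_le hL hC hT
  have hfW := integrable_comp_of_lipschitzWith_of_dist_le hL hC hW
  have hBC : Integrable (B.indicator fun _ => C) P := (integrable_const C).indicator₀ hB
  have pointwise : ∀ ω, |f (T ω) - f (W ω)| ≤ L * r + B.indicator (fun _ => C) ω := by
    intro ω
    rw [← Real.dist_eq]
    by_cases h : ω ∈ B
    · rw [Set.indicator_of_mem h]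
      exact (hC _ _).trans (le_add_of_nonneg_left (by positivity))
    · rw [Set.indicator_of_notMem h, add_zero]
      exact (hL.dist_le_mul _ _).trans (mul_le_mul_of_nonneg_left (not_lt.1 h) L.2)
  calc |∫ ω, f (T ω) ∂P - ∫ ω, f (W ω) ∂P| = |∫ ω, (f (T ω) - f (W ω)) ∂P| := by
        rw [integral_sub hfT hfW]
    _ ≤ ∫ ω, |f (T ω) - f (W ω)| ∂P := abs_integral_le_integral_abs
    _ ≤ ∫ ω, (L * r + B.indicator (fun _ => C) ω) ∂P :=
        integral_mono (hfT.sub hfW).abs ((integrable_const _).add hBC) pointwise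
    _ = L * r + P.real B * C := by
        rw [integral_add (integrable_const _) hBC, integral_indicator₀ hB]
        simp

theorem tendstoInDistribution_of_isNearLaw [SecondCountableTopology E] {ι : Type*}
    {F : Filter ι} [F.IsCountablyGenerated] {Ω : ι → Type*} [∀ l, MeasurableSpace (Ω l)]
    {P : (l : ι) → Measure (Ω l)} [∀ l, IsProbabilityMeasure (P l)] {γ : Measure E}
    [IsProbabilityMeasure γ] {T : (l : ι) → Ω l → E} (hT : ∀ l, AEMeasurable (T l) (P l))
    {r p : ι → ℝ} (hr : Tendsto r F (𝓝 0)) (hp : Tendsto p F (𝓝 0))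
    (hnear : ∀ᶠ l in F, IsNearLaw (r l) (p l) (T l) γ (P l)) :
    TendstoInDistribution T F (id : E → E) P γ := by
  refine ⟨hT, aemeasurable_id, tendsto_iff_forall_lipschitz_integral_tendsto.2 ?_⟩
  rintro f ⟨C, hC⟩ ⟨L, hL⟩
  simp only [ProbabilityMeasure.coe_mk, Measure.map_id]
  have hbound : Tendsto (fun l => L * |r l| + p l * C) F (𝓝 0) := by
    simpa using (hr.abs.const_mul (L : ℝ)).add (hp.mul_const C)
  rw [tendsto_iff_dist_tendsto_zero]
  refine squeeze_zero' (Eventually.of_forall fun _ => dist_nonneg) ?_ hbound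
  filter_upwards [hnear] with l ⟨W, hW, hbad⟩
  have hfm {μ : Measure E} : AEStronglyMeasurable f μ :=
    hL.continuous.measurable.aestronglyMeasurable
  have hC0 : 0 ≤ C := by
    obtain ⟨x⟩ := γ.nonempty_of_neZero
    exact dist_nonneg.trans (hC x x)
  rw [integral_map (hT l) hfm, ← hW.map_eq, integral_map hW.aemeasurable hfm, Real.dist_eq]
  refine (abs_integral_comp_sub_integral_comp_le hL hC (hT l) hW.aemeasurable
    (abs_nonneg (r l))).trans ?_
  gcongr
  have shrink : {ω | |r l| < dist (T l ω) (W ω)} ⊆ {ω | r l < dist (T l ω) (W ω)} :=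
    fun _ hω => (le_abs_self (r l)).trans_lt hω
  exact (measureReal_mono shrink).trans hbad

end NearLaw

section Quantile

theorem continuous_cdf (γ : Measure ℝ) [IsProbabilityMeasure γ] [NullSingletonClass γ] :
    Continuous (cdf γ) := by
  refine continuous_iff_continuousAt.2 fun x => ?_
  rw [(monotone_cdf γ).continuousAt_iff_leftLim_eq_rightLim, (cdf γ).rightLim_eq]
  have jump : ENNReal.ofReal (cdf γ x - Function.leftLim (cdf γ) x) = 0 := by
    rw [← (cdf γ).measure_singleton, measure_cdf, measure_singleton]
  exact le_antisymm ((monotone_cdf γ).leftLim_le le_rfl)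
    (sub_nonpos.1 (ENNReal.ofReal_eq_zero.1 jump))

theorem cdf_sInf_setOf_le_cdf (γ : Measure ℝ) [IsProbabilityMeasure γ] [NullSingletonClass γ]
    {q : ℝ} (hq0 : 0 < q) (hq1 : q < 1) : cdf γ (sInf {x | q ≤ cdf γ x}) = q := by
  have below := ((tendsto_cdf_atBot γ).eventually_lt_const hq0).exists
  have above := ((tendsto_cdf_atTop γ).eventually_const_le hq1).exists
  have hbdd : BddBelow {x | q ≤ cdf γ x} := by
    obtain ⟨y, hy⟩ := below
    exact ⟨y, fun x hx => ((monotone_cdf γ).reflect_lt (hy.trans_le hx)).le⟩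
  refine le_antisymm ?_ ((isClosed_le continuous_const (continuous_cdf γ)).csInf_mem above hbdd)
  obtain ⟨x, hx⟩ := mem_range_of_exists_le_of_exists_ge (continuous_cdf γ)
    (below.imp fun _ => le_of_lt) above
  exact (monotone_cdf γ (csInf_le hbdd hx.ge)).trans hx.le

theorem measureReal_Iio_neg (γ : Measure ℝ) [γ.IsNegInvariant] (z : ℝ) :
    γ.real (Set.Iio (-z)) = γ.real (Set.Ioi z) := by
  rw [measureReal_def, measureReal_def, ← Set.neg_Ioi, Measure.measure_neg]

theorem measureReal_Ioi_eq_one_sub_cdf (γ : Measure ℝ) [IsProbabilityMeasure γ] (z : ℝ) :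
    γ.real (Set.Ioi z) = 1 - cdf γ z := by
  rw [← Set.compl_Iic, probReal_compl_eq_one_sub measurableSet_Iic, cdf_eq_real]

theorem nonneg_of_half_lt_cdf {γ : Measure ℝ} [IsProbabilityMeasure γ] [γ.IsNegInvariant] {z : ℝ}
    (hz : 1 / 2 < cdf γ z) : 0 ≤ z := by
  by_contra! hneg
  have : γ.real (Set.Iic z) ≤ γ.real (Set.Iio (-z)) :=
    measureReal_mono (Set.Iic_subset_Iio.2 (by linarith))
  rw [measureReal_Iio_neg, measureReal_Ioi_eq_one_sub_cdf, ← cdf_eq_real] at this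
  linarith

theorem measureReal_lt_abs {γ : Measure ℝ} [IsProbabilityMeasure γ] [γ.IsNegInvariant] {z : ℝ}
    (hz : 0 ≤ z) : γ.real {x | z < |x|} = 2 * (1 - cdf γ z) := by
  have tails : {x : ℝ | z < |x|} = Set.Ioi z ∪ Set.Iio (-z) :=
    Set.ext fun x => (lt_abs (b := x)).trans (or_congr Iff.rfl lt_neg)
  have disjoint_tails : Disjoint (Set.Ioi z) (Set.Iio (-z)) :=
    Set.disjoint_left.2 fun x (hx : z < x) (hx' : x < -z) => by linarith
  rw [tails, measureReal_union disjoint_tails measurableSet_Iio, measureReal_Iio_neg,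
    measureReal_Ioi_eq_one_sub_cdf, two_mul]

theorem isNegInvariant_gaussianReal_zero (v : NNReal) : (gaussianReal 0 v).IsNegInvariant :=
  ⟨(gaussianReal_map_neg (μ := 0)).trans (by rw [neg_zero])⟩

theorem gaussianReal_real_stdNormalQuantile_lt_abs {α : ℝ} (hα0 : 0 < α) (hα1 : α < 1) :
    (gaussianReal 0 1).real {x | stdNormalQuantile (1 - α / 2) < |x|} = α := by
  have := nullSingletonClass_gaussianReal (μ := 0) one_ne_zero
  have := isNegInvariant_gaussianReal_zero 1
  have hcdf : cdf (gaussianReal 0 1) (stdNormalQuantile (1 - α / 2)) = 1 - α / 2 :=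
    cdf_sInf_setOf_le_cdf _ (by linarith) (by linarith)
  have hz : 0 ≤ stdNormalQuantile (1 - α / 2) :=
    nonneg_of_half_lt_cdf (γ := gaussianReal 0 1) (by linarith)
  rw [measureReal_lt_abs hz, hcdf]
  ring

end Quantile

section WaldInference

variable {ι : Type*} {F : Filter ι} {Ω : ι → Type*} [∀ l, MeasurableSpace (Ω l)]
  {P : (l : ι) → Measure (Ω l)} [∀ l, IsProbabilityMeasure (P l)]

theorem tendsto_measureReal_of_tendstoInDistribution {E : Type*} [MeasurableSpace E]
    [TopologicalSpace E] [OpensMeasurableSpace E] [HasOuterApproxClosed E] {γ : Measure E}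
    [IsProbabilityMeasure γ] {T : (l : ι) → Ω l → E}
    (hT : TendstoInDistribution T F (id : E → E) P γ) {A : Set E} (hA : MeasurableSet A)
    (hfr : γ (frontier A) = 0) :
    Tendsto (fun l => (P l).real {ω | T l ω ∈ A}) F (𝓝 (γ.real A)) := by
  have h := ProbabilityMeasure.tendsto_measure_of_null_frontier_of_tendsto' hT.tendsto (E := A)
    (by simpa only [ProbabilityMeasure.coe_mk, Measure.map_id] using hfr)
  simp only [ProbabilityMeasure.coe_mk, Measure.map_id] at h
  refine ((ENNReal.tendsto_toReal (measure_ne_top γ A)).comp h).congr fun l => ?_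
  rw [Function.comp_apply, Measure.map_apply_of_aemeasurable (hT.forall_aemeasurable l) hA]
  rfl

theorem frontier_lt_abs_subset (z : ℝ) : frontier {x : ℝ | z < |x|} ⊆ {z, -z} := fun _ hx =>
  eq_or_eq_neg_of_abs_eq (frontier_lt_subset_eq continuous_const continuous_abs hx).symm

theorem tendsto_measureReal_of_mem_iff_mem {A B D : (l : ι) → Set (Ω l)} {x : ℝ}
    (hA : Tendsto (fun l => (P l).real (A l)) F (𝓝 x))
    (hD : Tendsto (fun l => (P l).real (D l)) F (𝓝 0))
    (hAB : ∀ᶠ l in F, ∀ ω ∉ D l, ω ∈ A l ↔ ω ∈ B l) :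
    Tendsto (fun l => (P l).real (B l)) F (𝓝 x) := by
  have measureReal_le {l : ι} {A B D : Set (Ω l)} (h : A ⊆ B ∪ D) :
      (P l).real A ≤ (P l).real B + (P l).real D :=
    (measureReal_mono h).trans (measureReal_union_le B D)
  refine tendsto_of_tendsto_of_tendsto_of_le_of_le' (by simpa using hA.sub hD)
    (by simpa using hA.add hD) ?_ ?_
  all_goals filter_upwards [hAB] with l h
  · exact sub_le_iff_le_add.2 (measureReal_le fun ω hω =>
      or_iff_not_imp_right.2 fun hωD => (h ω hωD).1 hω)
  · exact measureReal_le fun ω hω => or_iff_not_imp_right.2 fun hωD => (h ω hωD).2 hω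

theorem tendsto_measureReal_stdNormalQuantile_lt_abs {T : (l : ι) → Ω l → ℝ}
    (hT : TendstoInDistribution T F (id : ℝ → ℝ) P (gaussianReal 0 1)) {α : ℝ} (hα0 : 0 < α)
    (hα1 : α < 1) :
    Tendsto (fun l => (P l).real {ω | stdNormalQuantile (1 - α / 2) < |T l ω|}) F (𝓝 α) := by
  have := nullSingletonClass_gaussianReal (μ := 0) one_ne_zero
  have h := tendsto_measureReal_of_tendstoInDistribution hT
    (A := {x | stdNormalQuantile (1 - α / 2) < |x|})
    (measurableSet_lt measurable_const measurable_id.abs)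
    (measure_mono_null (frontier_lt_abs_subset _) ((Set.toFinite _).measure_zero _))
  rwa [gaussianReal_real_stdNormalQuantile_lt_abs hα0 hα1] at h

theorem mem_Icc_iff_abs_studentizedError_le {N τ V b β z : ℝ} (hN : 0 < N) (hτ : 0 < τ)
    (hV : 0 < V) : β ∈ Set.Icc (b - z * τ * √(V / N)) (b + z * τ * √(V / N))
      ↔ |studentizedError N τ V b β| ≤ z := by
  have hsN : 0 < √N := Real.sqrt_pos.2 hN
  have hsV : 0 < τ * √V := mul_pos hτ (Real.sqrt_pos.2 hV)
  have halfwidth : z * τ * √(V / N) = z * (τ * √V) / √N := by rw [Real.sqrt_div hV.le]; ring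
  rw [studentizedError, abs_div, abs_mul, abs_of_pos hsN, abs_of_pos hsV, div_le_iff₀ hsV,
    mul_comm √N, ← le_div_iff₀ hsN, ← halfwidth, Set.mem_Icc_iff_abs_le]

theorem tendsto_measureReal_mem_confidenceInterval {N τ β : ι → ℝ} {b V : (l : ι) → Ω l → ℝ}
    (hN : ∀ᶠ l in F, 0 < N l) (hτ : ∀ l, 0 < τ l)
    (hV : Tendsto (fun l => (P l).real {ω | V l ω ≤ 0}) F (𝓝 0))
    (hT : TendstoInDistribution (fun l ω => studentizedError (N l) (τ l) (V l ω) (b l ω) (β l)) F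
      (id : ℝ → ℝ) P (gaussianReal 0 1)) {α : ℝ} (hα0 : 0 < α) (hα1 : α < 1) :
    Tendsto (fun l => (P l).real {ω | β l ∈ Set.Icc
        (b l ω - stdNormalQuantile (1 - α / 2) * τ l * √(V l ω / N l))
        (b l ω + stdNormalQuantile (1 - α / 2) * τ l * √(V l ω / N l))}) F (𝓝 (1 - α)) := by
  have accept : Tendsto (fun l => (P l).real {ω | stdNormalQuantile (1 - α / 2) <
      |studentizedError (N l) (τ l) (V l ω) (b l ω) (β l)|}ᶜ) F (𝓝 (1 - α)) := by
    have reject := tendsto_measureReal_stdNormalQuantile_lt_abs hT hα0 hα1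
    exact (reject.const_sub 1).congr fun l => (probReal_compl_eq_one_sub₀
      (nullMeasurableSet_lt aemeasurable_const (hT.forall_aemeasurable l).abs)).symm
  refine tendsto_measureReal_of_mem_iff_mem accept hV ?_
  filter_upwards [hN] with l hl ω hω
  exact not_lt.trans (mem_Icc_iff_abs_studentizedError_le hl (hτ l) (not_le.1 hω)).symm

theorem waldInference_of_isNearLaw [F.IsCountablyGenerated] {N τ β r p : ι → ℝ}
    {b V : (l : ι) → Ω l → ℝ} (hb : ∀ l, Measurable (b l)) (hVm : ∀ l, Measurable (V l))
    (hN : ∀ᶠ l in F, 0 < N l) (hτ : ∀ l, 0 < τ l) (hr : Tendsto r F (𝓝 0))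
    (hp : Tendsto p F (𝓝 0))
    (hnear : ∀ᶠ l in F, (P l).real {ω | V l ω ≤ 0} ≤ p l ∧
      IsNearLaw (r l) (p l) (fun ω => studentizedError (N l) (τ l) (V l ω) (b l ω) (β l))
        (gaussianReal 0 1) (P l)) :
    TendstoInDistribution (fun l ω => studentizedError (N l) (τ l) (V l ω) (b l ω) (β l)) F
        (id : ℝ → ℝ) P (gaussianReal 0 1) ∧
      ∀ α : ℝ, 0 < α → α < 1 →
        Tendsto (fun l => (P l).real {ω | β l ∈ Set.Icc
          (b l ω - stdNormalQuantile (1 - α / 2) * τ l * √(V l ω / N l))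
          (b l ω + stdNormalQuantile (1 - α / 2) * τ l * √(V l ω / N l))}) F (𝓝 (1 - α)) ∧
        ((∀ l, β l = 0) → Tendsto (fun l => (P l).real {ω | stdNormalQuantile (1 - α / 2) <
          |√(N l) * b l ω / (τ l * √(V l ω))|}) F (𝓝 α)) := by
  have hm (l : ι) : Measurable fun ω => studentizedError (N l) (τ l) (V l ω) (b l ω) (β l) :=
    (((hb l).sub_const (β l)).const_mul _).div ((hVm l).sqrt.const_mul _)
  have hT := tendstoInDistribution_of_isNearLaw (fun l => (hm l).aemeasurable) hr hp
    (hnear.mono fun _ h => h.2)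
  have hV : Tendsto (fun l => (P l).real {ω | V l ω ≤ 0}) F (𝓝 0) :=
    squeeze_zero' (Eventually.of_forall fun _ => measureReal_nonneg) (hnear.mono fun _ h => h.1) hp
  refine ⟨hT, fun α hα0 hα1 =>
    ⟨tendsto_measureReal_mem_confidenceInterval hN hτ hV hT hα0 hα1, fun hβ0 => ?_⟩⟩
  simpa only [studentizedError, hβ0, sub_zero] using
    tendsto_measureReal_stdNormalQuantile_lt_abs hT hα0 hα1

end WaldInference

section OneStepInference

variable {N n k s₁ s₂ : ℕ} {G : SimpleGraph (Fin n)} {β : Fin n → ℝ}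
  {S : Matrix (Fin n) (Fin n) ℝ} {σ τ c c' lamg lam mu ρ : ℝ}

theorem IsRegularSample.mono {κ κ' η η' ξ ξ' : ℝ} {X : Fin N → Fin n → ℝ} {ε : Fin N → ℝ}
    (h : IsRegularSample κ η ξ S X ε) (hκ : κ ≤ κ') (hη : η ≤ η') (hξ : ξ ≤ ξ') :
    IsRegularSample κ' η' ξ' S X ε where
  cov_close a b := (h.cov_close a b).trans hκ
  inv_feasible a b := (h.inv_feasible a b).trans hη
  score_le a := (h.score_le a).trans hξ

theorem IsRegularSample.abs_studentizedError_sub_le {κ : ℝ} {X : Fin N → Fin n → ℝ}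
    {ε : Fin N → ℝ} (hreg : IsRegularSample κ mu (lam / 2) S X ε) {b : Fin n → ℝ}
    {Θ : Matrix (Fin n) (Fin n) ℝ} (hN : 0 < N) (hτ : 0 < τ) (hc : 0 < c) (hherm : S.IsHermitian)
    (hS : spectrum ℝ S ⊆ Set.Icc c c') (hκ1 : κ ≤ 1) (hκs : 36 * s₂ * κ ≤ c / 2)
    (hβ : β ∈ paramSpace G k s₁ s₂) (hlam : 0 < lam) (hlamg : 0 ≤ lamg)
    (hpen : lamg * √(s₁ * (2 * (graphMaxDegree G : ℝ)) ^ (k + 1)) ≤ lam * √s₂)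
    (hb : IsGPPLasso G k lamg lam X (response X β ε) b)
    (hΘ : (climeFeasible (sampleCov X) mu).Nonempty → Θ ∈ climeFeasible (sampleCov X) mu)
    (hmu : mu ≤ 1 / 2) (j : Fin n) :
    0 < oneStepVar Θ X j ∧
      |studentizedError N τ (oneStepVar Θ X j) (oneStep Θ X (response X β ε) b j) (β j)
        - oneStepWeights Θ X j ⬝ᵥ ε / τ| ≤
        144 * √(c' + 1) / c * (√N * (mu * (lam * s₂)) / τ) := by
  have error : vecL1 (b - β) ≤ 72 / c * (lam * s₂) :=
    hb.vecL1_sub_le hlam hβ hlamg hpen hreg.score_le hc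
      (mul_sum_sq_le_dotProduct_mulVec hherm fun x hx => (hS hx).1)
      ((abs_nonneg _).trans (hreg.cov_close j j)) hreg.cov_close hκs
  have diag : sampleCov X j j ≤ c' + 1 := by
    have close := (abs_le.1 (hreg.cov_close j j)).2
    rw [Matrix.sub_apply] at close
    linarith [diag_le_of_spectrum_le hherm (fun x hx => (hS hx).2) j]
  refine (abs_studentizedError_oneStep_sub_le hN hτ (hΘ ⟨_, hreg.inv_feasible⟩) hmu diag
    error ε).imp_right fun h => h.trans_eq ?_
  ring

variable {Ω : Type*} [MeasurableSpace Ω] {P : Measure Ω} [IsProbabilityMeasure P]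
  {X : Ω → Fin N → Fin n → ℝ} {ε : Ω → Fin N → ℝ} {βhat : Ω → Fin n → ℝ}
  {Θhat : (Fin N → Fin n → ℝ) → Fin n → Fin n → ℝ}

theorem hasLaw_oneStepWeights_dotProduct_div (hX : Measurable X) (hε : IsGaussianNoise τ ε P)
    (hXε : IndepFun X ε P) (hN : 0 < N) (hτ : 0 < τ) (hΘ : Measurable Θhat) (j : Fin n) :
    HasLaw (fun ω => oneStepWeights (Matrix.of (Θhat (X ω))) (X ω) j ⬝ᵥ ε ω / τ)
      (gaussianReal 0 1) P where
  aemeasurable := by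
    have hw := (measurable_oneStepWeights hΘ j).comp hX
    refine (Measurable.div_const (Finset.measurable_sum _ fun i _ => ?_) τ).aemeasurable
    exact ((measurable_pi_apply i).comp hw).mul (hε.measurable_apply i)
  map_eq := hε.map_comp_dotProduct_div hτ hX hXε (measurable_oneStepWeights hΘ j)
    fun x => sum_sq_oneStepWeights hN _ x j

theorem isNearLaw_studentizedError_oneStep (hX : IsRowwiseSubGaussian σ S X P)
    (hε : IsGaussianNoise τ ε P) (hXε : IndepFun X ε P) (hN : 0 < N) (hσ : 0 < σ) (hτ : 0 < τ)
    (hc : 0 < c) (hS : spectrum ℝ S ⊆ Set.Icc c c') (hρ : 0 ≤ ρ) (hρ2 : ρ ≤ 1 / 2)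
    (hρ1 : 36 * σ ^ 2 * ρ ≤ 1) (hρs : 36 * s₂ * (36 * σ ^ 2 * ρ) ≤ c / 2)
    (hβ : β ∈ paramSpace G k s₁ s₂) (hlam : 0 < lam) (hlamρ : 36 * (σ * τ) * ρ ≤ lam / 2)
    (hlamg : 0 ≤ lamg)
    (hpen : lamg * √(s₁ * (2 * (graphMaxDegree G : ℝ)) ^ (k + 1)) ≤ lam * √s₂)
    (hmuρ : 36 * σ ^ 2 / c * ρ ≤ mu) (hmu : mu ≤ 1 / 2)
    (hb : ∀ᵐ ω ∂P, IsGPPLasso G k lamg lam (X ω) (response (X ω) β (ε ω)) (βhat ω))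
    (hΘm : Measurable Θhat)
    (hΘ : ∀ᵐ ω ∂P, (climeFeasible (sampleCov (X ω)) mu).Nonempty →
      Matrix.of (Θhat (X ω)) ∈ climeFeasible (sampleCov (X ω)) mu) (j : Fin n) :
    P.real {ω | oneStepVar (Matrix.of (Θhat (X ω))) (X ω) j ≤ 0}
        ≤ 6 * n ^ 2 * Real.exp (-(4 * (N * ρ ^ 2))) ∧
      IsNearLaw (144 * √(c' + 1) / c * (√N * (mu * (lam * s₂)) / τ))
        (6 * n ^ 2 * Real.exp (-(4 * (N * ρ ^ 2))))
        (fun ω => studentizedError N τ (oneStepVar (Matrix.of (Θhat (X ω))) (X ω) j)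
          (oneStep (Matrix.of (Θhat (X ω))) (X ω) (response (X ω) β (ε ω)) (βhat ω) j) (β j))
        (gaussianReal 0 1) P := by
  have good := hb.and hΘ |>.mono fun ω h hreg =>
    (IsRegularSample.mono hreg le_rfl hmuρ hlamρ).abs_studentizedError_sub_le hN hτ hc
      (hX.isHermitian hN) hS hρ1 hρs hβ hlam hlamg hpen h.1 h.2 hmu j
  have bad {q : Ω → Prop} (hq : ∀ᵐ ω ∂P, q ω → ¬ IsRegularSample (36 * σ ^ 2 * ρ)
      (36 * σ ^ 2 / c * ρ) (36 * (σ * τ) * ρ) S (X ω) (ε ω)) :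
      P.real {ω | q ω} ≤ 6 * n ^ 2 * Real.exp (-(4 * (N * ρ ^ 2))) :=
    (ENNReal.toReal_mono (measure_ne_top _ _) (measure_mono_ae hq)).trans
      (hX.measureReal_not_isRegularSample_le hε hXε hN hσ hτ hc (fun x hx => (hS hx).1) hρ hρ2)
  refine ⟨bad ?_, _, hasLaw_oneStepWeights_dotProduct_div hX.measurable hε hXε hN hτ hΘm j, bad ?_⟩
  · filter_upwards [good] with ω hω hV hreg
    exact (hω hreg).1.not_ge hV
  · filter_upwards [good] with ω hω hfar hreg
    exact (hω hreg).2.not_gt hfar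

end OneStepInference

section SparseRegime

theorem mul_sqrt_div_mul_sqrt_mul_le {a ν E s₁ s₂ : ℝ} (ha : 0 ≤ a) (hE : 0 ≤ E) (hν : 0 ≤ ν)
    (hs₁ : 0 < s₁) (hratio : ν ≤ s₂ / s₁) : a * √(ν / E) * √(s₁ * E) ≤ a * √s₂ := by
  have hνs : ν * s₁ ≤ s₂ := (le_div_iff₀ hs₁).1 hratio
  rw [mul_assoc, ← Real.sqrt_mul (div_nonneg hν hE)]
  gcongr
  calc ν / E * (s₁ * E) = ν * s₁ * (E / E) := by ring
    _ ≤ ν * s₁ * 1 := by gcongr; exact div_self_le_one E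
    _ ≤ s₂ := by rwa [mul_one]

theorem sq_mul_exp_neg_mul_sq_sqrt_log_div {N n : ℕ} (hN : 0 < N) (hn : 0 < n) :
    6 * (n : ℝ) ^ 2 * Real.exp (-(4 * (N * √(Real.log n / N) ^ 2))) = 6 / (n : ℝ) ^ 2 := by
  have exponent : -(4 * (N * √(Real.log n / N) ^ 2)) = -((4 : ℕ) * Real.log n) := by
    rw [Real.sq_sqrt (by positivity)]
    push_cast
    field_simp
  rw [exponent, Real.exp_neg, Real.exp_nat_mul, Real.exp_log (by positivity)]
  field_simp

theorem sqrt_mul_mul_div_le {N n s : ℕ} {τ lam mu C : ℝ} (hτ : 0 < τ)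
    (hlam : lam ≤ C * (τ * √(Real.log n / N))) (hlam0 : 0 ≤ lam)
    (hmu : mu ≤ C * √(Real.log n / N)) (hmu0 : 0 ≤ mu) :
    √N * (mu * (lam * s)) / τ ≤ C ^ 2 * (s * Real.log n / √N) := by
  have hprod : mu * lam ≤ C * √(Real.log n / N) * (C * (τ * √(Real.log n / N))) :=
    mul_le_mul hmu hlam hlam0 (hmu0.trans hmu)
  calc √N * (mu * (lam * s)) / τ = √N * s / τ * (mu * lam) := by ring
    _ ≤ √N * s / τ * (C * √(Real.log n / N) * (C * (τ * √(Real.log n / N)))) := by gcongr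
    _ = C ^ 2 * s * (√N * √(Real.log n / N) ^ 2) := by field_simp
    _ = C ^ 2 * s * (Real.log n * (√N / N)) := by
      rw [Real.sq_sqrt (by positivity)]
      ring
    _ = C ^ 2 * (s * Real.log n / √N) := by
      rw [Real.sqrt_div_self']
      ring

variable {ι : Type*} {F : Filter ι} {N n s : ι → ℕ}

theorem tendsto_mul_sqrt_log_div (hn : Tendsto n F atTop)
    (h : Tendsto (fun l => s l * Real.log (n l) / √(N l)) F (𝓝 0)) :
    Tendsto (fun l => s l * √(Real.log (n l) / N l)) F (𝓝 0) := by
  refine squeeze_zero' (Eventually.of_forall fun l => by positivity) ?_ h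
  have hlog : Tendsto (fun l => Real.log (n l)) F atTop :=
    Real.tendsto_log_atTop.comp (tendsto_natCast_atTop_atTop.comp hn)
  filter_upwards [hlog.eventually_ge_atTop 1] with l hl
  have hsqrt : √(Real.log (n l)) ≤ Real.log (n l) :=
    (Real.sqrt_le_left (zero_le_one.trans hl)).2 (le_self_pow₀ hl two_ne_zero)
  rw [Real.sqrt_div (zero_le_one.trans hl), mul_div_assoc]
  gcongr

theorem tendsto_sqrt_log_div (hn : Tendsto n F atTop) (hs : ∀ l, 0 < s l)
    (h : Tendsto (fun l => s l * Real.log (n l) / √(N l)) F (𝓝 0)) :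
    Tendsto (fun l => √(Real.log (n l) / N l)) F (𝓝 0) :=
  squeeze_zero (fun _ => Real.sqrt_nonneg _)
    (fun l => le_mul_of_one_le_left (Real.sqrt_nonneg _) (by exact_mod_cast hs l))
    (tendsto_mul_sqrt_log_div hn h)

theorem tendsto_sqrt_mul_mul_div {τ lam mu : ι → ℝ} {C : ℝ} (hτ : ∀ l, 0 < τ l)
    (hlam : ∀ l, lam l ∈ Set.Icc 0 (C * (τ l * √(Real.log (n l) / N l))))
    (hmu : ∀ l, mu l ∈ Set.Icc 0 (C * √(Real.log (n l) / N l)))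
    (h : Tendsto (fun l => s l * Real.log (n l) / √(N l)) F (𝓝 0)) :
    Tendsto (fun l => √(N l) * (mu l * (lam l * s l)) / τ l) F (𝓝 0) := by
  refine squeeze_zero (fun l => ?_) (fun l => sqrt_mul_mul_div_le (hτ l) (hlam l).2 (hlam l).1
    (hmu l).2 (hmu l).1) (by simpa using h.const_mul (C ^ 2))
  have := (hτ l).le
  have := (hlam l).1
  have := (hmu l).1
  positivity

theorem tendsto_sq_mul_exp_neg_mul_sq_sqrt_log_div (hN : Tendsto N F atTop)
    (hn : Tendsto n F atTop) :
    Tendsto (fun l => 6 * (n l : ℝ) ^ 2 * Real.exp (-(4 * (N l * √(Real.log (n l) / N l) ^ 2))))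
      F (𝓝 0) := by
  have hinv : Tendsto (fun l => 6 / (n l : ℝ) ^ 2) F (𝓝 0) :=
    tendsto_const_nhds.div_atTop
      ((tendsto_pow_atTop two_ne_zero).comp (tendsto_natCast_atTop_atTop.comp hn))
  refine hinv.congr' ?_
  filter_upwards [hN.eventually_gt_atTop 0, hn.eventually_gt_atTop 0] with l hNl hnl
  exact (sq_mul_exp_neg_mul_sq_sqrt_log_div hNl hnl).symm

end SparseRegime

theorem corollary2_general (cmin σx : ℝ) (hcmin : 0 < cmin) (hσx : 0 < σx) :
    ∃ C₀ : ℝ, 0 < C₀ ∧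
    ∀ (cmax C₁ : ℝ) (k N n s₁ s₂ : ℕ → ℕ) (σε lam lamg mu : ℕ → ℝ)
      (G : (l : ℕ) → SimpleGraph (Fin (n l)))
      (βstar : (l : ℕ) → Fin (n l) → ℝ)
      (S : (l : ℕ) → Matrix (Fin (n l)) (Fin (n l)) ℝ)
      (Ω : ℕ → Type*) [∀ l, MeasurableSpace (Ω l)]
      (P : (l : ℕ) → Measure (Ω l)) [∀ l, IsProbabilityMeasure (P l)]
      (X : (l : ℕ) → Ω l → Fin (N l) → Fin (n l) → ℝ)
      (ε : (l : ℕ) → Ω l → Fin (N l) → ℝ)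
      (βhat : (l : ℕ) → Ω l → Fin (n l) → ℝ)
      (Θhat : (l : ℕ) → (Fin (N l) → Fin (n l) → ℝ) → Fin (n l) → Fin (n l) → ℝ)
      (j : (l : ℕ) → Fin (n l)),
    Tendsto N atTop atTop → Tendsto n atTop atTop →
    (∀ l, 0 < s₂ l ∧ βstar l ∈ paramSpace (G l) (k l) (s₁ l) (s₂ l)) →
    (∀ l, IsRowwiseSubGaussian σx (S l) (X l) (P l)) →
    (∀ l, spectrum ℝ (S l) ⊆ Set.Icc cmin cmax) →
    (∀ l, 0 < σε l ∧ IsGaussianNoise (σε l) (ε l) (P l)) →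
    (∀ l, IndepFun (X l) (ε l) (P l)) →
    (∀ l, lam l ∈ Set.Icc (C₀ * (σε l * √(Real.log (n l) / N l)))
      (C₁ * (σε l * √(Real.log (n l) / N l)))) →
    (∀ l, 0 ≤ lamg l ∧
      lamg l * √(s₁ l * (2 * (graphMaxDegree (G l) : ℝ)) ^ (k l + 1)) ≤ lam l * √(s₂ l)) →
    (∀ l, mu l ∈ Set.Icc (C₀ * √(Real.log (n l) / N l)) (C₁ * √(Real.log (n l) / N l))) →
    (∀ l, Measurable (βhat l)) →
    (∀ l, ∀ᵐ ω ∂(P l), IsGPPLasso (G l) (k l) (lamg l) (lam l) (X l ω)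
      (response (X l ω) (βstar l) (ε l ω)) (βhat l ω)) →
    (∀ l, Measurable (Θhat l)) →
    (∀ l, ∀ᵐ ω ∂(P l), (climeFeasible (sampleCov (X l ω)) (mu l)).Nonempty →
      Matrix.of (Θhat l (X l ω)) ∈ climeFeasible (sampleCov (X l ω)) (mu l)) →
    Tendsto (fun l => (s₂ l : ℝ) * Real.log (n l) / √(N l : ℝ)) atTop (𝓝 0) →
    let βtilde : (l : ℕ) → Ω l → ℝ := fun l ω =>
      oneStep (Matrix.of (Θhat l (X l ω))) (X l ω)
        (response (X l ω) (βstar l) (ε l ω)) (βhat l ω) (j l)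
    let V : (l : ℕ) → Ω l → ℝ := fun l ω =>
      oneStepVar (Matrix.of (Θhat l (X l ω))) (X l ω) (j l)
    TendstoInDistribution
      (fun l ω => √(N l : ℝ) * (βtilde l ω - βstar l (j l)) / (σε l * √(V l ω)))
      atTop (id : ℝ → ℝ) P (gaussianReal 0 1) ∧
    ∀ α : ℝ, 0 < α → α < 1 →
      Tendsto (fun l => (P l).real {ω | βstar l (j l) ∈ Set.Icc
          (βtilde l ω - stdNormalQuantile (1 - α / 2) * σε l * √(V l ω / N l))
          (βtilde l ω + stdNormalQuantile (1 - α / 2) * σε l * √(V l ω / N l))})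
        atTop (𝓝 (1 - α)) ∧
      ((∀ l, βstar l (j l) = 0) →
        Tendsto (fun l => (P l).real {ω | stdNormalQuantile (1 - α / 2) <
            |√(N l : ℝ) * βtilde l ω / (σε l * √(V l ω))|})
          atTop (𝓝 α)) := by
  refine ⟨36 * σx ^ 2 / cmin + 72 * σx, by positivity, ?_⟩
  intro cmax C₁ k N n s₁ s₂ σε lam lamg mu G βstar S Ω _ P _ X ε βhat Θhat j hN hn hβ hX hS hε hXε
    hlam hlamg hmu hbm hb hΘm hΘ hrate βtilde V
  have sparse_rate := tendsto_mul_sqrt_log_div hn hrate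
  have rate := tendsto_sqrt_log_div hn (fun l => (hβ l).1) hrate
  have remainder := tendsto_sqrt_mul_mul_div (fun l => (hε l).1)
    (fun l => ⟨(hlam l).1.trans' (mul_nonneg (by positivity) (mul_nonneg (hε l).1.le
      (Real.sqrt_nonneg _))), (hlam l).2⟩)
    (fun l => ⟨(hmu l).1.trans' (by positivity), (hmu l).2⟩) hrate
  refine waldInference_of_isNearLaw
    (fun l => measurable_oneStep_apply (hX l).measurable (hε l).2.measurable (hbm l)
      ((hΘm l).comp (hX l).measurable) (βstar l) (j l))
    (fun l => (measurable_oneStepVar (hΘm l) (j l)).comp (hX l).measurable)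
    (tendsto_natCast_atTop_atTop.comp hN |>.eventually_gt_atTop 0) (fun l => (hε l).1)
    (by simpa using remainder.const_mul (144 * √(cmax + 1) / cmin))
    (tendsto_sq_mul_exp_neg_mul_sq_sqrt_log_div hN hn) ?_
  filter_upwards [rate.eventually_le_const (u := 1 / 2) (by norm_num),
    (rate.const_mul (36 * σx ^ 2)).eventually_le_const (u := 1) (by simp),
    (sparse_rate.const_mul (36 * (36 * σx ^ 2))).eventually_le_const (u := cmin / 2)
      (by simpa using hcmin),
    (rate.const_mul C₁).eventually_le_const (u := 1 / 2) (by simp),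
    hN.eventually_gt_atTop 0, hn.eventually_gt_atTop 1] with l hρ2 hρ1 hρs hmu2 hNl hnl
  have hρ : 0 < √(Real.log (n l) / N l) :=
    Real.sqrt_pos.2 (div_pos (Real.log_pos (by exact_mod_cast hnl)) (by exact_mod_cast hNl))
  have hτ := (hε l).1
  refine isNearLaw_studentizedError_oneStep (hX l) (hε l).2 (hXε l) hNl hσx hτ hcmin
    (hS l) hρ.le hρ2 hρ1 (by linarith) (hβ l).2 ((hlam l).1.trans_lt' (by positivity)) ?_
    (hlamg l).1 (hlamg l).2 ((hmu l).1.trans' ?_) ((hmu l).2.trans hmu2) (hb l) (hΘm l) (hΘ l) (j l)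
  · have : 0 ≤ 36 * σx ^ 2 / cmin * (σε l * √(Real.log (n l) / N l)) := by positivity
    linarith [(hlam l).1]
  · gcongr
    exact le_add_of_nonneg_right (by positivity)

theorem corollary2 (cmin cmax σx : ℝ) (hcmin : 0 < cmin) (hcmax : 0 < cmax) (hσx : 0 < σx) :
    -- the constants implied in the lower bounds for the tuning parameters
    ∃ C₀ : ℝ, 0 < C₀ ∧
    ∀ (C₁ : ℝ) (k : ℕ) (ν : ℝ), 0 ≤ ν → ν < 1 →
    ∀ (N n s₁ s₂ : ℕ → ℕ) (σε M lam lamg mu : ℕ → ℝ)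
      (G : (l : ℕ) → SimpleGraph (Fin (n l)))
      (βstar : (l : ℕ) → Fin (n l) → ℝ)
      (S : (l : ℕ) → Matrix (Fin (n l)) (Fin (n l)) ℝ)
      (Ω : ℕ → Type*) [∀ l, MeasurableSpace (Ω l)]
      (P : (l : ℕ) → Measure (Ω l)) [∀ l, IsProbabilityMeasure (P l)]
      (X : (l : ℕ) → Ω l → Fin (N l) → Fin (n l) → ℝ)
      (ε : (l : ℕ) → Ω l → Fin (N l) → ℝ)
      (βhat : (l : ℕ) → Ω l → Fin (n l) → ℝ)
      (Θhat : (l : ℕ) → (Fin (N l) → Fin (n l) → ℝ) → Fin (n l) → Fin (n l) → ℝ)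
      (j : (l : ℕ) → Fin (n l)),
    -- the asymptotic regime
    Tendsto N atTop atTop → Tendsto n atTop atTop →
    -- the linear model with a sub-Gaussian random design and an independent Gaussian noise
    (∀ l, 0 < s₁ l ∧ 0 < s₂ l ∧ βstar l ∈ paramSpace (G l) k (s₁ l) (s₂ l)) →
    (∀ l, ν ≤ (s₂ l : ℝ) / (s₁ l : ℝ)) →
    (∀ l, IsRowwiseSubGaussian σx (S l) (X l) (P l)) →
    (∀ l, spectrum ℝ (S l) ⊆ Set.Icc cmin cmax) →
    (∀ l a, ∑ b, |(S l)⁻¹ a b| ≤ M l) →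
    (∀ l, 0 < σε l ∧ IsGaussianNoise (σε l) (ε l) (P l)) →
    (∀ l, IndepFun (X l) (ε l) (P l)) →
    -- the tuning parameters
    (∀ l, lam l ∈ Set.Icc (C₀ * (σε l * √(Real.log (n l) / N l)))
      (C₁ * (σε l * √(Real.log (n l) / N l)))) →
    (∀ l, lamg l = lam l * √(ν / (2 * (graphMaxDegree (G l) : ℝ)) ^ (k + 1))) →
    (∀ l, mu l ∈ Set.Icc (C₀ * √(Real.log (n l) / N l)) (C₁ * √(Real.log (n l) / N l))) →
    -- the Graph-Piecewise-Polynomial-Lasso and the CLIME estimator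
    (∀ l, Measurable (βhat l)) →
    (∀ l, ∀ᵐ ω ∂(P l), IsGPPLasso (G l) k (lamg l) (lam l) (X l ω)
      (response (X l ω) (βstar l) (ε l ω)) (βhat l ω)) →
    (∀ l, Measurable (Θhat l)) →
    (∀ l, ∀ᵐ ω ∂(P l), (climeFeasible (sampleCov (X l ω)) (mu l)).Nonempty →
      IsCLIME (sampleCov (X l ω)) (mu l) (Matrix.of (Θhat l (X l ω)))) →
    -- the rate conditions
    Tendsto (fun l => (s₂ l : ℝ) * Real.log (n l) / √(N l : ℝ)) atTop (𝓝 0) →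
    Tendsto (fun l => M l * √(Real.log (n l) / N l)) atTop (𝓝 0) →
    -- the one-step estimator of the `j`-th coefficient and its variance factor
    let βtilde : (l : ℕ) → Ω l → ℝ := fun l ω =>
      oneStep (Matrix.of (Θhat l (X l ω))) (X l ω)
        (response (X l ω) (βstar l) (ε l ω)) (βhat l ω) (j l)
    let V : (l : ℕ) → Ω l → ℝ := fun l ω =>
      oneStepVar (Matrix.of (Θhat l (X l ω))) (X l ω) (j l)
    -- asymptotic normality
    TendstoInDistribution
      (fun l ω => √(N l : ℝ) * (βtilde l ω - βstar l (j l)) / (σε l * √(V l ω)))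
      atTop (id : ℝ → ℝ) P (gaussianReal 0 1) ∧
    ∀ α : ℝ, 0 < α → α < 1 →
      -- asymptotic coverage of the confidence interval
      Tendsto (fun l => (P l).real {ω | βstar l (j l) ∈ Set.Icc
          (βtilde l ω - stdNormalQuantile (1 - α / 2) * σε l * √(V l ω / N l))
          (βtilde l ω + stdNormalQuantile (1 - α / 2) * σε l * √(V l ω / N l))})
        atTop (𝓝 (1 - α)) ∧
      -- asymptotic size of the two-sided test of `βstar l (j l) = 0`
      ((∀ l, βstar l (j l) = 0) →
        Tendsto (fun l => (P l).real {ω | stdNormalQuantile (1 - α / 2) <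
            |√(N l : ℝ) * βtilde l ω / (σε l * √(V l ω))|})
          atTop (𝓝 α)) := by
  obtain ⟨C₀, hC₀, general⟩ := corollary2_general cmin σx hcmin hσx
  refine ⟨C₀, hC₀, ?_⟩
  intro C₁ k ν hν _ N n s₁ s₂ σε M lam lamg mu G βstar S Ω _ P _ X ε βhat Θhat j hN hn hβ hratio
    hX hS _ hε hXε hlam hlamg hmu hbm hb hΘm hΘ hrate _
  have hlam0 (l : ℕ) : 0 ≤ lam l :=
    (hlam l).1.trans' (mul_nonneg hC₀.le (mul_nonneg (hε l).1.le (Real.sqrt_nonneg _)))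
  refine general cmax C₁ (fun _ => k) N n s₁ s₂ σε lam lamg mu G βstar S Ω P X ε βhat Θhat j hN hn
    (fun l => (hβ l).2) hX hS hε hXε hlam (fun l => ?_) hmu hbm hb hΘm
    (fun l => (hΘ l).mono fun _ h hne => (h hne).1) hrate
  rw [hlamg l]
  exact ⟨mul_nonneg (hlam0 l) (Real.sqrt_nonneg _), mul_sqrt_div_mul_sqrt_mul_le (hlam0 l)
    (by positivity) hν (by exact_mod_cast (hβ l).1) (hratio l)⟩
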